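/- Let $N\in\mathbb N$, $c,\tau,r>0$, $T>0$. For $t>0$ let $n(t)\in\mathbb N_0$ be the integer with $t\in(n(t)\tau,(n(t)+1)\tau]$. Causal diffusion with initial state $u$ is defined by $v(\cdot,0)=u$ and, for $t>0$, $$v(x,t)=\frac1{|S_1(0)|}\int_{S_1(0)} v\bigl(x+R(t)\,y,\;n(t)\tau\bigr)\,d\sigma(y),\qquad R(t)=c\,(t-n(t)\tau),$$ where $\sigma$ is the surface measure of the unit sphere of $\mathbb R^N$. Its Green function $G_{c,\tau}(\cdot,t)$ is the probability measure obtained in the same way from $u=\delta$, and $\hat G_{c,\tau}(k,t)=(2\pi)^{-N/2}\int e^{ik\cdot x}\,dG_{c,\tau}(x,t)$. The envelope of a bounded function $g$ on $\mathbb R^N$ is $E_g(\rho)=\sup_{|k|\ge\rho}|g(k)|$. Let $\Omega_0\subseteq B_r(0)$ be open and non-empty, let $\Omega_T=B_{r+cT}(0)$, and extend functions on $\Omega_0$ and $\Omega_T$ by zero. The spaces $L^2$ may be real or complex. The problem $F(u)=w$ is called ill-posed if its solution is not unique or does not depend continuously on $w\in\operatorname{range}F$. For an operator with symbol $g$ it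 is called exponentially ill-posed if it is ill-posed and $E_g(\rho)=O(e^{-a\rho^b})$ as $\rho\to\infty$ for some $a,b>0$. **Corollary.** Let $N=2$ and $T>2\tau$, or $N\ge3$ and $T>\tau$. Then $u\mapsto v(\cdot,T)$ defines a bounded linear operator $F_T:L^2(\Omega_0)\to L^2(\Omega_T)$, and $F_T(u)=G_{c,\tau}(\cdot,T)*u$. The space $L^2(\Omega_0)$ is infinite-dimensional, $F_T$ is compact and injective, and the inverse problem $F_T(u)=w$ is ill-posed. The envelope of the symbol decreases exactly at a polynomial rate: there are $A,B>0$ such that for all sufficiently large $\rho$ $$A\,\rho^{-\lceil T/\tau\rceil (N-1)/2}\;\le\;\sup_{|k|\ge\rho}|\hat G_{c,\tau}(k,T)|\;\le\;B\,\rho^{-\lceil T/\tau\rceil (N-1)/2}.$$ In particular, the inverse problem is not exponentially ill-posed. -/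

import Mathlib

open MeasureTheory Metric Filter Asymptotics

/-- The number `n(t) ∈ ℕ` of completed time steps before time `t`: for `t > 0` it is the natural
number with `t ∈ (n(t) τ, (n(t) + 1) τ]`, see `stepCount_spec`. -/
noncomputable def stepCount (τ t : ℝ) : ℕ := ⌈t / τ⌉₊ - 1

theorem stepCount_spec {τ t : ℝ} (hτ : 0 < τ) (ht : 0 < t) (n : ℕ) :
    n = stepCount τ t ↔ (n : ℝ) * τ < t ∧ t ≤ ((n : ℝ) + 1) * τ := by
  have h1 : 0 < ⌈t / τ⌉₊ := Nat.ceil_pos.2 (div_pos ht hτ)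
  have h2 : n = stepCount τ t ↔ ⌈t / τ⌉₊ = n + 1 := by
    unfold stepCount
    omega
  rw [h2, Nat.ceil_eq_iff (Nat.succ_ne_zero n), lt_div_iff₀ hτ, div_le_iff₀ hτ]
  simp

/-- The mean value of `f` over the sphere `S_R(x)` with respect to the surface measure, written as
the mean value of `y ↦ f (x + R y)` over the unit sphere. -/
noncomputable def sphericalMean {N : ℕ} {𝕜 : Type*} [RCLike 𝕜] (R : ℝ)
    (f : EuclideanSpace ℝ (Fin N) → 𝕜) (x : EuclideanSpace ℝ (Fin N)) : 𝕜 :=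
  ⨍ y : sphere (0 : EuclideanSpace ℝ (Fin N)) 1,
    f (x + R • (y : EuclideanSpace ℝ (Fin N)))
      ∂(volume : Measure (EuclideanSpace ℝ (Fin N))).toSphere

/-- The states `v(·, n τ)`, `n = 0, 1, 2, …`, of causal diffusion with initial state `u`. -/
noncomputable def diffusionState {N : ℕ} {𝕜 : Type*} [RCLike 𝕜] (c τ : ℝ)
    (u : EuclideanSpace ℝ (Fin N) → 𝕜) : ℕ → EuclideanSpace ℝ (Fin N) → 𝕜
  | 0 => u
  | n + 1 => sphericalMean (c * τ) (diffusionState c τ u n)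

/-- Causal diffusion `t ↦ v(·, t)` with speed `c`, time step `τ` and initial state `u`:
`v(·, 0) = u`, and for `t > 0` the value `v(x, t)` is the mean of `v(·, n(t) τ)` over the sphere
with centre `x` and radius `c (t - n(t) τ)`, see `causalDiffusion_of_pos`. -/
noncomputable def causalDiffusion {N : ℕ} {𝕜 : Type*} [RCLike 𝕜] (c τ : ℝ)
    (u : EuclideanSpace ℝ (Fin N) → 𝕜) (t : ℝ) : EuclideanSpace ℝ (Fin N) → 𝕜 :=
  if t ≤ 0 then u
  else sphericalMean (c * (t - stepCount τ t * τ)) (diffusionState c τ u (stepCount τ t))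

theorem causalDiffusion_zero {N : ℕ} {𝕜 : Type*} [RCLike 𝕜] (c τ : ℝ)
    (u : EuclideanSpace ℝ (Fin N) → 𝕜) : causalDiffusion c τ u 0 = u := by
  simp [causalDiffusion]

theorem causalDiffusion_nat_mul {N : ℕ} {𝕜 : Type*} [RCLike 𝕜] (c : ℝ) {τ : ℝ} (hτ : 0 < τ)
    (u : EuclideanSpace ℝ (Fin N) → 𝕜) (n : ℕ) :
    causalDiffusion c τ u (n * τ) = diffusionState c τ u n := by
  cases n with
  | zero => simp [causalDiffusion, diffusionState]
  | succ n =>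
    have hpos : (0 : ℝ) < ((n + 1 : ℕ) : ℝ) * τ := by positivity
    have hn : stepCount τ (((n + 1 : ℕ) : ℝ) * τ) = n := by
      refine ((stepCount_spec hτ hpos n).2 ⟨?_, ?_⟩).symm <;> push_cast <;> nlinarith
    rw [causalDiffusion, if_neg (not_le.2 hpos), hn, diffusionState]
    congr 1
    push_cast
    ring

theorem causalDiffusion_of_pos {N : ℕ} {𝕜 : Type*} [RCLike 𝕜] (c : ℝ) {τ t : ℝ} (hτ : 0 < τ)
    (ht : 0 < t) (u : EuclideanSpace ℝ (Fin N) → 𝕜) :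
    causalDiffusion c τ u t =
      sphericalMean (c * (t - stepCount τ t * τ)) (causalDiffusion c τ u (stepCount τ t * τ)) := by
  rw [causalDiffusion_nat_mul c hτ, causalDiffusion, if_neg (not_le.2 ht)]

/-- The spherical mean of radius `R` of a measure `μ`, the extension of `sphericalMean` from
functions (densities) to measures: if `μ` has density `f`, the integral of a test function `φ`
against it is `∫ φ(x) ⨍ f(x + R y) dσ(y) dx = ∫ ⨍ φ(x - R y) dσ(y) dμ(x)`. -/
noncomputable def sphericalMeanMeasure {N : ℕ} (R : ℝ)
    (μ : Measure (EuclideanSpace ℝ (Fin N))) : Measure (EuclideanSpace ℝ (Fin N)) :=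
  let σ := (volume : Measure (EuclideanSpace ℝ (Fin N))).toSphere
  (μ.prod ((σ Set.univ)⁻¹ • σ)).map
    (fun p : EuclideanSpace ℝ (Fin N) × sphere (0 : EuclideanSpace ℝ (Fin N)) 1 =>
      p.1 - R • (p.2 : EuclideanSpace ℝ (Fin N)))

/-- The states at the times `n τ` of causal diffusion started in the delta distribution. -/
noncomputable def greenState (N : ℕ) (c τ : ℝ) : ℕ → Measure (EuclideanSpace ℝ (Fin N))
  | 0 => Measure.dirac 0
  | n + 1 => sphericalMeanMeasure (c * τ) (greenState N c τ n)

/-- The Green function `G(·, t)` of causal diffusion, that is causal diffusion with the delta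
distribution as initial state, as a measure on `ℝ^N`. -/
noncomputable def greenMeasure (N : ℕ) (c τ t : ℝ) : Measure (EuclideanSpace ℝ (Fin N)) :=
  if t ≤ 0 then Measure.dirac 0
  else sphericalMeanMeasure (c * (t - stepCount τ t * τ)) (greenState N c τ (stepCount τ t))

/-- The Fourier transform `Ĝ(k, t) = (2π)^{-N/2} ∫ e^{i k·x} dG(x, t)` of the Green function. -/
noncomputable def greenFourier (N : ℕ) (c τ t : ℝ) (k : EuclideanSpace ℝ (Fin N)) : ℂ :=
  (((2 * Real.pi) ^ (-(N : ℝ) / 2) : ℝ) : ℂ) * charFun (greenMeasure N c τ t) k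

/-- The envelope of a bounded function `g` on `ℝ^N`: the least nonincreasing function of `|k|`
that bounds `|g(k)|`, namely `r ↦ sup {|g(k)| : |k| ≥ r}`. -/
noncomputable def envelope {N : ℕ} (g : EuclideanSpace ℝ (Fin N) → ℂ) (r : ℝ) : ℝ :=
  ⨆ k : {k : EuclideanSpace ℝ (Fin N) // r ≤ ‖k‖}, ‖g k‖

/-- The inverse problem `F u = w` is ill-posed, even for attainable data `w`: the solution is
not unique, or it does not depend continuously on `w ∈ range F`. In other words `F` is not
injective with continuous inverse `range F → X`. -/
def IllPosed {X Y : Type*} [TopologicalSpace X] [TopologicalSpace Y] (F : X → Y) : Prop :=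
  ¬ Topology.IsEmbedding F

/-- The inverse problem `F u = w` for an operator `F` with Fourier symbol `g` is exponentially
ill-posed: it is ill-posed and the envelope of the symbol decreases exponentially fast, at least
like `exp (-a |k| ^ b)` for some `a, b > 0`. -/
def ExponentiallyIllPosed {X Y : Type*} [TopologicalSpace X] [TopologicalSpace Y] {N : ℕ}
    (F : X → Y) (g : EuclideanSpace ℝ (Fin N) → ℂ) : Prop :=
  IllPosed F ∧ ∃ a b : ℝ, 0 < a ∧ 0 < b ∧
    envelope g =O[atTop] fun r : ℝ => Real.exp (-a * r ^ b)

/-! Each spherical mean is convolution with a rescaled copy of the normalised surface measure of the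
sphere. The characteristic function of the Green measure is therefore a product of n + 1 = ⌈T/τ⌉
radial factors: φ(cτ|k|)^n φ(R|k|), where φ is the profile `sphereProfile` and R ∈ (0, cτ] is the
last radius.

Rotation invariance alone yields Bessel's equation φ'' + (N-1)/s φ' + φ = 0 (`sphereProfile_ode`).
With α = (N-1)/2, the function w = s^α φ solves w'' = (κ/s² - 1) w with κ = α(α-1), an integrable
perturbation of the harmonic oscillator. Its energy w² + w'² stays between positive constants for
large s, and w(s) - C cos(s - θ) → 0 for some C > 0. Three facts follow. Upper bound: |φ(s)| =
O((1+s)^(-α)), so Ĝ is O(|k|^(-⌈T/τ⌉α)). Lower bound: every window of a fixed length contains a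
radius at which both cosines are bounded away from 0 (`exists_delta_le_abs_cos_mul_sub`), so the
exponent is sharp. Isolated zeros: a double zero of φ at a positive point would annihilate the
energy.

The conditions on N and T give ⌈T/τ⌉(N-1) > N, which makes Ĝ square integrable. By Plancherel and
Bessel's inequality the operator is then Hilbert–Schmidt, hence compact. Isolated zeros and the
continuity of the Fourier transform of u give injectivity. A compact operator on an
infinite-dimensional Hilbert space cannot be a topological embedding, hence ill-posedness. The
polynomial lower bound excludes exponential decay. -/

/-! ### The normalised surface measure and its rotation invariance. -/

/-- The normalised surface measure of the unit sphere, as a measure on the whole space. -/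
noncomputable def unitSphereMeasure (N : ℕ) : Measure (EuclideanSpace ℝ (Fin N)) :=
  (((volume : Measure (EuclideanSpace ℝ (Fin N))).toSphere Set.univ)⁻¹ •
    (volume : Measure (EuclideanSpace ℝ (Fin N))).toSphere).map Subtype.val

theorem measurableEmbedding_sphere_coe (N : ℕ) :
    MeasurableEmbedding (Subtype.val : sphere (0 : EuclideanSpace ℝ (Fin N)) 1 → _) :=
  MeasurableEmbedding.subtype_coe isClosed_sphere.measurableSet

instance unitSphereMeasure.isProbabilityMeasure (N : ℕ) [NeZero N] :
    IsProbabilityMeasure (unitSphereMeasure N) := by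
  have : Nontrivial (EuclideanSpace ℝ (Fin N)) := by
    refine ⟨⟨0, EuclideanSpace.single 0 1, ?_⟩⟩
    intro h
    have := congrArg (fun v => v 0) h
    simp at this
  have h := Measure.toSphere_ne_zero (volume : Measure (EuclideanSpace ℝ (Fin N)))
  have : NeZero (volume : Measure (EuclideanSpace ℝ (Fin N))).toSphere := ⟨h⟩
  have := isProbabilityMeasureSMul
    (μ := (volume : Measure (EuclideanSpace ℝ (Fin N))).toSphere)
  exact Measure.isProbabilityMeasure_map measurable_subtype_coe.aemeasurable

theorem ae_norm_eq_one_unitSphereMeasure (N : ℕ) : ∀ᵐ y ∂unitSphereMeasure N, ‖y‖ = 1 := by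
  rw [unitSphereMeasure, (measurableEmbedding_sphere_coe N).ae_map_iff]
  exact Eventually.of_forall fun y => by simp

-- The surface measure of a set is a multiple of the volume of the cone over it. A linear isometry
-- maps cones to cones and preserves volume.
open scoped Pointwise in
theorem map_unitSphereMeasure {N : ℕ}
    (L : EuclideanSpace ℝ (Fin N) ≃ₗᵢ[ℝ] EuclideanSpace ℝ (Fin N)) :
    (unitSphereMeasure N).map L = unitSphereMeasure N := by
  ext s hs
  have hL : Measurable L := L.continuous.measurable
  rw [Measure.map_apply hL hs, unitSphereMeasure,
    Measure.map_apply measurable_subtype_coe (hL hs), Measure.map_apply measurable_subtype_coe hs,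
    Measure.smul_apply, Measure.smul_apply,
    Measure.toSphere_apply' _ (measurable_subtype_coe (hL hs)),
    Measure.toSphere_apply' _ (measurable_subtype_coe hs)]
  congr 2
  have : (Set.Ioo (0 : ℝ) 1 • (Subtype.val '' (Subtype.val ⁻¹' (L ⁻¹' s) :
      Set (sphere (0 : EuclideanSpace ℝ (Fin N)) 1)))) = L ⁻¹' (Set.Ioo (0 : ℝ) 1 •
        (Subtype.val '' (Subtype.val ⁻¹' s : Set (sphere (0 : EuclideanSpace ℝ (Fin N)) 1)))) := by
    ext x
    simp only [Set.mem_smul, Set.mem_preimage, Set.mem_image, Subtype.exists, exists_and_right,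
      exists_eq_right, mem_sphere_zero_iff_norm]
    constructor
    · rintro ⟨t, ht, y, ⟨hy, hys⟩, rfl⟩
      exact ⟨t, ht, L y, ⟨by simpa using hy, hys⟩, by simp⟩
    · rintro ⟨t, ht, y, ⟨hy, hys⟩, hx⟩
      refine ⟨t, ht, L.symm y, ⟨by simpa using hy, by simpa using hys⟩, ?_⟩
      apply L.injective
      simpa using hx
  rw [this]
  exact L.measurePreserving.measure_preimage_emb L.toHomeomorph.measurableEmbedding _

theorem integral_comp_linearIsometryEquiv_unitSphereMeasure {N : ℕ} {F : Type*}
    [NormedAddCommGroup F] [NormedSpace ℝ F]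
    (L : EuclideanSpace ℝ (Fin N) ≃ₗᵢ[ℝ] EuclideanSpace ℝ (Fin N))
    (f : EuclideanSpace ℝ (Fin N) → F) :
    ∫ y, f (L y) ∂unitSphereMeasure N = ∫ y, f y ∂unitSphereMeasure N := by
  conv_rhs => rw [← map_unitSphereMeasure L]
  exact (L.toHomeomorph.measurableEmbedding.integral_map f).symm

theorem sphericalMean_eq_integral {N : ℕ} {𝕜 : Type*} [RCLike 𝕜] (R : ℝ)
    (f : EuclideanSpace ℝ (Fin N) → 𝕜) (x : EuclideanSpace ℝ (Fin N)) :
    sphericalMean R f x = ∫ y, f (x + R • y) ∂unitSphereMeasure N := by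
  rw [unitSphereMeasure, (measurableEmbedding_sphere_coe N).integral_map]
  rfl

/-! ### The Green measure: total mass, support and characteristic function. -/

theorem sphericalMeanMeasure_eq_map {N : ℕ} [NeZero N] (R : ℝ)
    (μ : Measure (EuclideanSpace ℝ (Fin N))) [SFinite μ] :
    sphericalMeanMeasure R μ =
      (μ.prod (unitSphereMeasure N)).map fun p => p.1 - R • p.2 := by
  rw [sphericalMeanMeasure, unitSphereMeasure]
  set σ := (volume : Measure (EuclideanSpace ℝ (Fin N))).toSphere
  have h := Measure.map_prod_map μ ((σ Set.univ)⁻¹ • σ)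
    (measurable_id (α := EuclideanSpace ℝ (Fin N)))
    (measurable_subtype_coe (p := fun x => x ∈ sphere (0 : EuclideanSpace ℝ (Fin N)) 1))
  rw [Measure.map_id] at h
  rw [h, Measure.map_map (by fun_prop) (by fun_prop)]
  rfl

theorem isProbabilityMeasure_sphericalMeanMeasure {N : ℕ} [NeZero N] (R : ℝ)
    (μ : Measure (EuclideanSpace ℝ (Fin N))) [IsProbabilityMeasure μ] :
    IsProbabilityMeasure (sphericalMeanMeasure R μ) := by
  rw [sphericalMeanMeasure_eq_map]
  exact Measure.isProbabilityMeasure_map (by fun_prop)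

instance greenState.isProbabilityMeasure (N : ℕ) [NeZero N] (c τ : ℝ) (n : ℕ) :
    IsProbabilityMeasure (greenState N c τ n) := by
  induction n with
  | zero => exact Measure.dirac.isProbabilityMeasure
  | succ n ih => exact isProbabilityMeasure_sphericalMeanMeasure _ _

instance greenMeasure.isProbabilityMeasure (N : ℕ) [NeZero N] (c τ t : ℝ) :
    IsProbabilityMeasure (greenMeasure N c τ t) := by
  unfold greenMeasure
  split_ifs
  · exact Measure.dirac.isProbabilityMeasure
  · exact isProbabilityMeasure_sphericalMeanMeasure _ _

theorem ae_norm_le_sphericalMeanMeasure {N : ℕ} [NeZero N] {R ρ : ℝ} (hR : 0 ≤ R)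
    {μ : Measure (EuclideanSpace ℝ (Fin N))} [SFinite μ] (hμ : ∀ᵐ x ∂μ, ‖x‖ ≤ ρ) :
    ∀ᵐ x ∂sphericalMeanMeasure R μ, ‖x‖ ≤ ρ + R := by
  rw [sphericalMeanMeasure_eq_map, ae_map_iff (by fun_prop)
    (measurableSet_le measurable_norm measurable_const)]
  have h1 := Measure.quasiMeasurePreserving_fst (μ := μ) (ν := unitSphereMeasure N) |>.ae hμ
  have h2 := Measure.quasiMeasurePreserving_snd (μ := μ) (ν := unitSphereMeasure N) |>.ae
    (ae_norm_eq_one_unitSphereMeasure N)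
  filter_upwards [h1, h2] with p hp1 hp2
  calc ‖p.1 - R • p.2‖ ≤ ‖p.1‖ + ‖R • p.2‖ := norm_sub_le _ _
    _ ≤ ρ + R := by
      rw [norm_smul, hp2, Real.norm_of_nonneg hR, mul_one]
      gcongr

theorem ae_norm_le_greenState {N : ℕ} [NeZero N] {c τ : ℝ} (hcτ : 0 ≤ c * τ) (n : ℕ) :
    ∀ᵐ x ∂greenState N c τ n, ‖x‖ ≤ n * (c * τ) := by
  induction n with
  | zero =>
    rw [greenState, ae_dirac_iff (measurableSet_le measurable_norm measurable_const)]
    simp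
  | succ n ih =>
    have := ae_norm_le_sphericalMeanMeasure hcτ ih
    filter_upwards [this] with x hx
    push_cast
    linarith

/-- Finite speed of propagation: the radii of the n full steps and of the last partial step add up
to c t. -/
theorem ae_norm_le_greenMeasure {N : ℕ} [NeZero N] {c τ t : ℝ} (hc : 0 < c) (hτ : 0 < τ)
    (ht : 0 < t) : ∀ᵐ x ∂greenMeasure N c τ t, ‖x‖ ≤ c * t := by
  have hs := (stepCount_spec hτ ht _).1 rfl
  rw [greenMeasure, if_neg (not_le.2 ht)]
  have hR : 0 ≤ c * (t - stepCount τ t * τ) := mul_nonneg hc.le (by linarith [hs.1])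
  filter_upwards [ae_norm_le_sphericalMeanMeasure hR
    (ae_norm_le_greenState (by positivity : 0 ≤ c * τ) (stepCount τ t))] with x hx
  linarith

/-- The measure is the law of X - R Y with X and Y independent, Y uniform on the sphere, so
characteristic functions multiply. -/
theorem charFun_sphericalMeanMeasure {N : ℕ} [NeZero N] (R : ℝ)
    (μ : Measure (EuclideanSpace ℝ (Fin N))) [IsProbabilityMeasure μ]
    (k : EuclideanSpace ℝ (Fin N)) :
    charFun (sphericalMeanMeasure R μ) k =
      charFun μ k * charFun (unitSphereMeasure N) ((-R) • k) := by
  rw [sphericalMeanMeasure_eq_map, ← charFun_map_smul]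
  have : IsProbabilityMeasure ((unitSphereMeasure N).map fun y => (-R) • y) :=
    Measure.isProbabilityMeasure_map (by fun_prop)
  rw [← charFun_conv, Measure.conv]
  have h := Measure.map_prod_map μ (unitSphereMeasure N)
    (measurable_id (α := EuclideanSpace ℝ (Fin N)))
    (show Measurable fun y : EuclideanSpace ℝ (Fin N) => (-R) • y by fun_prop)
  rw [Measure.map_id] at h
  rw [h, Measure.map_map (by fun_prop) (by fun_prop)]
  congr 2
  ext1 p
  simp [sub_eq_add_neg]

theorem charFun_greenState {N : ℕ} [NeZero N] (c τ : ℝ) (n : ℕ) (k : EuclideanSpace ℝ (Fin N)) :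
    charFun (greenState N c τ n) k =
      charFun (unitSphereMeasure N) ((-(c * τ)) • k) ^ n := by
  induction n with
  | zero => simp [greenState]
  | succ n ih => rw [greenState, charFun_sphericalMeanMeasure, ih, pow_succ]

theorem charFun_greenMeasure {N : ℕ} [NeZero N] {c τ t : ℝ} (ht : 0 < t)
    (k : EuclideanSpace ℝ (Fin N)) :
    charFun (greenMeasure N c τ t) k =
      charFun (unitSphereMeasure N) ((-(c * τ)) • k) ^ stepCount τ t *
        charFun (unitSphereMeasure N) ((-(c * (t - stepCount τ t * τ))) • k) := by
  rw [greenMeasure, if_neg (not_le.2 ht), charFun_sphericalMeanMeasure, charFun_greenState]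

/-! ### The radial profile and Bessel's equation. -/

/-- The radial profile of the characteristic function of the normalised surface measure. -/
noncomputable def sphereProfile (N : ℕ) [NeZero N] (s : ℝ) : ℝ :=
  ∫ y, Real.cos (s * y 0) ∂unitSphereMeasure N

section SphereProfile

variable {N : ℕ}

theorem ae_abs_apply_le_one_unitSphereMeasure :
    ∀ᵐ y ∂unitSphereMeasure N, ∀ j, |y j| ≤ 1 := by
  filter_upwards [ae_norm_eq_one_unitSphereMeasure N] with y hy j
  rw [← hy, ← Real.norm_eq_abs]
  exact PiLp.norm_apply_le y j

theorem integrable_unitSphereMeasure_of_bound [NeZero N] {f : EuclideanSpace ℝ (Fin N) → ℝ}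
    (hf : Continuous f) (C : ℝ) (hC : ∀ y, (∀ j, |y j| ≤ 1) → |f y| ≤ C) :
    Integrable f (unitSphereMeasure N) := by
  refine Integrable.of_bound hf.aestronglyMeasurable C ?_
  filter_upwards [ae_abs_apply_le_one_unitSphereMeasure] with y hy
  exact hC y hy

/-- The reflection in the hyperplane orthogonal to a fixes b and changes the sign of a, so the
integrand is odd under a symmetry of the measure. -/
theorem integral_inner_mul_sin_inner_eq_zero {a b : EuclideanSpace ℝ (Fin N)}
    (hab : inner ℝ a b = 0) :
    ∫ y, inner ℝ a y * Real.sin (inner ℝ b y) ∂unitSphereMeasure N = 0 := by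
  have h := integral_comp_linearIsometryEquiv_unitSphereMeasure ((ℝ ∙ a)ᗮ.reflection)
    fun y => inner ℝ a y * Real.sin (inner ℝ b y)
  have key : ∀ v y, inner ℝ v ((ℝ ∙ a)ᗮ.reflection y) = inner ℝ ((ℝ ∙ a)ᗮ.reflection v) y := by
    intro v y
    rw [← ((ℝ ∙ a)ᗮ.reflection).inner_map_map v, Submodule.reflection_reflection]
  have ha : (ℝ ∙ a)ᗮ.reflection a = -a := Submodule.reflection_orthogonalComplement_singleton_eq_neg a
  have hb : (ℝ ∙ a)ᗮ.reflection b = b :=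
    Submodule.reflection_mem_subspace_eq_self (Submodule.mem_orthogonal_singleton_iff_inner_right.2 hab)
  simp only [key, ha, hb, inner_neg_left, neg_mul, integral_neg] at h
  linarith

variable [NeZero N]

/-- A reflection carries ‖k‖ e₀ to k, which reduces the real part to the profile; the symmetry y ↦
-y removes the imaginary part. -/
theorem charFun_unitSphereMeasure (k : EuclideanSpace ℝ (Fin N)) :
    charFun (unitSphereMeasure N) k = sphereProfile N ‖k‖ := by
  set e : EuclideanSpace ℝ (Fin N) := EuclideanSpace.single 0 ‖k‖ with he
  have hnorm : ‖e‖ = ‖k‖ := by simp [he]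
  set L := (ℝ ∙ (e - k))ᗮ.reflection
  have hL : L e = k := Submodule.reflection_sub hnorm
  have hcos : ∫ y, Real.cos (inner ℝ y k) ∂unitSphereMeasure N = sphereProfile N ‖k‖ := by
    rw [sphereProfile, ← integral_comp_linearIsometryEquiv_unitSphereMeasure L]
    simp_rw [← hL, L.inner_map_map, he]
    congr 1
    ext y
    simp [EuclideanSpace.inner_single_right]
  have hsin : ∫ y, Real.sin (inner ℝ y k) ∂unitSphereMeasure N = 0 := by
    have h := integral_comp_linearIsometryEquiv_unitSphereMeasure (LinearIsometryEquiv.neg ℝ)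
      fun y : EuclideanSpace ℝ (Fin N) => Real.sin (inner ℝ y k)
    simp only [LinearIsometryEquiv.coe_neg, inner_neg_left, Real.sin_neg, integral_neg] at h
    linarith
  rw [charFun_apply, ← hcos]
  have hi1 : Integrable (fun y : EuclideanSpace ℝ (Fin N) => Real.cos (inner ℝ y k))
      (unitSphereMeasure N) :=
    Integrable.of_bound (by fun_prop) 1 (Eventually.of_forall fun y => Real.abs_cos_le_one _)
  have hi2 : Integrable (fun y : EuclideanSpace ℝ (Fin N) => Real.sin (inner ℝ y k))
      (unitSphereMeasure N) :=
    Integrable.of_bound (by fun_prop) 1 (Eventually.of_forall fun y => Real.abs_sin_le_one _)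
  calc ∫ y, Complex.exp (inner ℝ y k * Complex.I) ∂unitSphereMeasure N
      = ∫ y, ((Real.cos (inner ℝ y k) : ℂ) + (Real.sin (inner ℝ y k) : ℂ) * Complex.I)
          ∂unitSphereMeasure N := by
        congr 1
        ext y
        rw [Complex.exp_mul_I]
        push_cast
        rfl
    _ = _ := by
        rw [integral_add hi1.ofReal (hi2.ofReal.mul_const _), integral_mul_const]
        have h1 := integral_ofReal (𝕜 := ℂ) (μ := unitSphereMeasure N)
          (f := fun y => Real.cos (inner ℝ y k))
        have h2 := integral_ofReal (𝕜 := ℂ) (μ := unitSphereMeasure N)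
          (f := fun y => Real.sin (inner ℝ y k))
        simp only [Complex.coe_algebraMap] at h1 h2
        rw [h1, h2, hsin]
        simp

theorem sphereProfile_zero : sphereProfile N 0 = 1 := by
  simp [sphereProfile]

theorem abs_sphereProfile_le_one (s : ℝ) : |sphereProfile N s| ≤ 1 := by
  have := norm_integral_le_of_norm_le_const (μ := unitSphereMeasure N)
    (f := fun y => Real.cos (s * y 0)) (C := 1)
    (Eventually.of_forall fun y => Real.abs_cos_le_one _)
  simpa [sphereProfile] using this

theorem hasDerivAt_sphereProfile (s : ℝ) :
    HasDerivAt (sphereProfile N) (∫ y, -(y 0 * Real.sin (s * y 0)) ∂unitSphereMeasure N) s := by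
  refine (hasDerivAt_integral_of_dominated_loc_of_deriv_le (μ := unitSphereMeasure N)
    (F := fun s y => Real.cos (s * y 0)) (F' := fun s y => -(y 0 * Real.sin (s * y 0)))
    (bound := fun _ => 1) univ_mem
    (Eventually.of_forall fun s => by fun_prop) ?_ (by fun_prop) ?_ (integrable_const _) ?_).2
  · exact Integrable.of_bound (by fun_prop) 1 (Eventually.of_forall fun y => Real.abs_cos_le_one _)
  · filter_upwards [ae_abs_apply_le_one_unitSphereMeasure] with y hy t _
    rw [norm_neg, Real.norm_eq_abs, abs_mul]
    exact mul_le_one₀ (hy 0) (abs_nonneg _) (Real.abs_sin_le_one _)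
  · refine Eventually.of_forall fun y t _ => ?_
    have := (hasDerivAt_mul_const (x := t) (y 0)).cos
    exact this.congr_deriv (by ring)

theorem hasDerivAt_sphereProfile_deriv (s : ℝ) :
    HasDerivAt (fun s => ∫ y, -(y 0 * Real.sin (s * y 0)) ∂unitSphereMeasure N)
      (∫ y, -(y 0 ^ 2 * Real.cos (s * y 0)) ∂unitSphereMeasure N) s := by
  refine (hasDerivAt_integral_of_dominated_loc_of_deriv_le (μ := unitSphereMeasure N)
    (F := fun s y => -(y 0 * Real.sin (s * y 0)))
    (F' := fun s y => -(y 0 ^ 2 * Real.cos (s * y 0)))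
    (bound := fun _ => 1) univ_mem
    (Eventually.of_forall fun s => by fun_prop) ?_ (by fun_prop) ?_ (integrable_const _) ?_).2
  · refine integrable_unitSphereMeasure_of_bound (by fun_prop) 1 fun y hy => ?_
    rw [abs_neg, abs_mul]
    exact mul_le_one₀ (hy 0) (abs_nonneg _) (Real.abs_sin_le_one _)
  · filter_upwards [ae_abs_apply_le_one_unitSphereMeasure] with y hy t _
    rw [norm_neg, Real.norm_eq_abs, abs_mul, abs_pow]
    exact mul_le_one₀ (pow_le_one₀ (abs_nonneg _) (hy 0)) (abs_nonneg _) (Real.abs_cos_le_one _)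
  · refine Eventually.of_forall fun y t _ => ?_
    have := (((hasDerivAt_mul_const (x := t) (y 0)).sin).const_mul (y 0)).neg
    exact this.congr_deriv (by ring)

/-- This replaces integration by parts on the sphere. The vectors e_j - h e₀ and s(e₀ + h e_j) are
orthogonal for every h, so `integral_inner_mul_sin_inner_eq_zero` gives a function of h that
vanishes identically; its derivative at h = 0 is the difference of the two sides. -/
theorem mul_integral_sq_mul_cos_eq (s : ℝ) {j : Fin N} (hj : j ≠ 0) :
    s * ∫ y, y j ^ 2 * Real.cos (s * y 0) ∂unitSphereMeasure N =
      ∫ y, y 0 * Real.sin (s * y 0) ∂unitSphereMeasure N := by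
  have hzero : ∀ h : ℝ,
      ∫ y, (y j - h * y 0) * Real.sin (s * (y 0 + h * y j)) ∂unitSphereMeasure N = 0 := by
    intro h
    have := integral_inner_mul_sin_inner_eq_zero
      (a := EuclideanSpace.single j 1 - h • EuclideanSpace.single (0 : Fin N) (1 : ℝ))
      (b := s • (EuclideanSpace.single (0 : Fin N) 1 + h • EuclideanSpace.single j (1 : ℝ)))
      (by simp [inner_sub_left, inner_add_right, inner_smul_left, inner_smul_right,
        EuclideanSpace.inner_single_left, hj, hj.symm])
    simpa [inner_sub_left, inner_add_left, inner_smul_left,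
      EuclideanSpace.inner_single_left, mul_add] using this
  have hder := (hasDerivAt_integral_of_dominated_loc_of_deriv_le (μ := unitSphereMeasure N)
    (F := fun h y => (y j - h * y 0) * Real.sin (s * (y 0 + h * y j)))
    (F' := fun h y => -y 0 * Real.sin (s * (y 0 + h * y j)) +
      (y j - h * y 0) * (Real.cos (s * (y 0 + h * y j)) * (s * y j)))
    (x₀ := 0) (s := ball 0 1)
    (bound := fun _ => 1 + 2 * |s|) (ball_mem_nhds _ one_pos)
    (Eventually.of_forall fun s => by fun_prop) ?_ (by fun_prop) ?_ (integrable_const _) ?_).2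
  · simp_rw [hzero] at hder
    have h0 := hder.unique (hasDerivAt_const _ _)
    simp only [zero_mul, add_zero, sub_zero] at h0
    rw [integral_add] at h0
    · rw [← integral_const_mul]
      have e1 : ∫ y, -y 0 * Real.sin (s * y 0) ∂unitSphereMeasure N =
          -∫ y, y 0 * Real.sin (s * y 0) ∂unitSphereMeasure N := by
        simp_rw [neg_mul, integral_neg]
      have e2 : ∫ y, y j * (Real.cos (s * y 0) * (s * y j)) ∂unitSphereMeasure N =
          ∫ y, s * (y j ^ 2 * Real.cos (s * y 0)) ∂unitSphereMeasure N := by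
        congr 1
        ext y
        ring
      rw [e1, e2] at h0
      linarith
    · refine integrable_unitSphereMeasure_of_bound (by fun_prop) 1 fun y hy => ?_
      rw [neg_mul, abs_neg, abs_mul]
      exact mul_le_one₀ (hy 0) (abs_nonneg _) (Real.abs_sin_le_one _)
    · refine integrable_unitSphereMeasure_of_bound (by fun_prop) (1 * (1 * (|s| * 1)))
        fun y hy => ?_
      rw [abs_mul, abs_mul, abs_mul]
      gcongr
      exacts [hy j, Real.abs_cos_le_one _, hy j]
  · refine integrable_unitSphereMeasure_of_bound (by fun_prop) 1 fun y hy => ?_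
    rw [abs_mul]
    exact mul_le_one₀ (by simpa using hy j) (abs_nonneg _) (Real.abs_sin_le_one _)
  · filter_upwards [ae_abs_apply_le_one_unitSphereMeasure] with y hy h hh
    have hh' : |h| ≤ 1 := by simpa using (mem_ball_zero_iff.1 hh).le
    have h1 : |y j - h * y 0| ≤ 2 := by
      calc |y j - h * y 0| ≤ |y j| + |h * y 0| := abs_sub _ _
        _ ≤ 1 + 1 * 1 := by
          rw [abs_mul]
          gcongr
          exacts [hy j, hy 0]
        _ = 2 := by norm_num
    rw [Real.norm_eq_abs]
    refine (abs_add_le _ _).trans ?_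
    simp only [abs_mul, abs_neg]
    calc |y 0| * |Real.sin (s * (y 0 + h * y j))| +
          |y j - h * y 0| * (|Real.cos (s * (y 0 + h * y j))| * (|s| * |y j|))
        ≤ 1 * 1 + 2 * (1 * (|s| * 1)) := by
          gcongr
          exacts [hy 0, Real.abs_sin_le_one _, Real.abs_cos_le_one _, hy j]
      _ = 1 + 2 * |s| := by ring
  · refine Eventually.of_forall fun y h _ => ?_
    have d1 : HasDerivAt (fun h : ℝ => y j - h * y 0) (-y 0) h := by
      simpa using (hasDerivAt_mul_const (x := h) (y 0)).const_sub (y j)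
    have d2 : HasDerivAt (fun h : ℝ => s * (y 0 + h * y j)) (s * y j) h := by
      simpa using ((hasDerivAt_mul_const (x := h) (y j)).const_add (y 0)).const_mul s
    exact d1.mul d2.sin

/-- Bessel's equation for the radial profile: `φ'' + (N - 1) / s φ' + φ = 0`. -/
theorem sphereProfile_ode (s : ℝ) :
    s * (sphereProfile N s + ∫ y, -(y 0 ^ 2 * Real.cos (s * y 0)) ∂unitSphereMeasure N) =
      -((N : ℝ) - 1) * ∫ y, -(y 0 * Real.sin (s * y 0)) ∂unitSphereMeasure N := by
  have hint : ∀ j : Fin N,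
      Integrable (fun y => y j ^ 2 * Real.cos (s * y 0)) (unitSphereMeasure N) := by
    intro j
    refine integrable_unitSphereMeasure_of_bound (by fun_prop) 1 fun y hy => ?_
    rw [abs_mul, abs_pow]
    exact mul_le_one₀ (pow_le_one₀ (abs_nonneg _) (hy j)) (abs_nonneg _) (Real.abs_cos_le_one _)
  -- Insert 1 = ∑ y_j² under the integral. The term j = 0 cancels φ''; each of the other N - 1
  -- terms, multiplied by s, equals -φ'.
  have hsum : sphereProfile N s =
      ∑ j, ∫ y, y j ^ 2 * Real.cos (s * y 0) ∂unitSphereMeasure N := by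
    rw [← integral_finsetSum _ fun j _ => hint j, sphereProfile]
    refine integral_congr_ae ?_
    filter_upwards [ae_norm_eq_one_unitSphereMeasure N] with y hy
    have : ∑ j, y j ^ 2 = 1 := by
      rw [← EuclideanSpace.real_norm_sq_eq, hy, one_pow]
    rw [← Finset.sum_mul, this, one_mul]
  rw [hsum, ← Finset.add_sum_erase _ _ (Finset.mem_univ (0 : Fin N)), integral_neg, integral_neg]
  have : s * ∑ j ∈ Finset.univ.erase (0 : Fin N),
      ∫ y, y j ^ 2 * Real.cos (s * y 0) ∂unitSphereMeasure N =
        ((N : ℝ) - 1) * ∫ y, y 0 * Real.sin (s * y 0) ∂unitSphereMeasure N := by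
    rw [Finset.mul_sum, Finset.sum_congr rfl fun j hj =>
      mul_integral_sq_mul_cos_eq s (Finset.ne_of_mem_erase hj), Finset.sum_const,
      Finset.card_erase_of_mem (Finset.mem_univ _), Finset.card_univ, Fintype.card_fin,
      nsmul_eq_mul, Nat.cast_sub (NeZero.one_le), Nat.cast_one]
  linear_combination this

end SphereProfile

/-! ### Solutions of w'' = (κ/s² - 1) w: energy bounds and asymptotics. -/

section PerturbedOscillator

open Topology

variable {w w' : ℝ → ℝ} {κ : ℝ}

theorem hasDerivAt_energy {s : ℝ} (hw : HasDerivAt w (w' s) s)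
    (hw' : HasDerivAt w' ((κ / s ^ 2 - 1) * w s) s) :
    HasDerivAt (fun s => w s ^ 2 + w' s ^ 2) (2 * (κ / s ^ 2) * (w s * w' s)) s := by
  refine ((hw.pow 2).add (hw'.pow 2)).congr_deriv ?_
  simp
  ring

theorem abs_energy_deriv_le (s : ℝ) :
    |2 * (κ / s ^ 2) * (w s * w' s)| ≤ |κ| / s ^ 2 * (w s ^ 2 + w' s ^ 2) := by
  rw [mul_right_comm, mul_comm _ (κ / s ^ 2), abs_mul, abs_div, abs_of_nonneg (sq_nonneg s)]
  refine mul_le_mul_of_nonneg_left ?_ (by positivity)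
  rw [abs_le]
  constructor <;> nlinarith [sq_nonneg (w s + w' s), sq_nonneg (w s - w' s)]

theorem hasDerivAt_exp_div {s : ℝ} (hs : 0 < s) (a : ℝ) :
    HasDerivAt (fun s => Real.exp (a / s)) (-(a / s ^ 2) * Real.exp (a / s)) s := by
  have := ((hasDerivAt_inv hs.ne').const_mul a).exp
  simp only [← div_eq_mul_inv] at this
  refine this.congr_deriv ?_
  ring

/-- The relative growth rate of the energy is at most |κ|/s², which is exactly the decay rate of the
factor exp(|κ|/s). This factor tends to 1 at infinity, so the energy stays bounded. -/
theorem energy_mul_exp_antitoneOn (hw : ∀ s, 0 < s → HasDerivAt w (w' s) s)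
    (hw' : ∀ s, 0 < s → HasDerivAt w' ((κ / s ^ 2 - 1) * w s) s) :
    AntitoneOn (fun s => (w s ^ 2 + w' s ^ 2) * Real.exp (|κ| / s)) (Set.Ioi 0) := by
  have hd : ∀ s, 0 < s → HasDerivAt (fun s => (w s ^ 2 + w' s ^ 2) * Real.exp (|κ| / s)) _ s :=
    fun s hs => (hasDerivAt_energy (hw s hs) (hw' s hs)).mul (hasDerivAt_exp_div hs |κ|)
  refine antitoneOn_of_deriv_nonpos (convex_Ioi 0)
    (fun s hs => (hd s hs).continuousAt.continuousWithinAt) ?_ ?_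
  · rw [interior_Ioi]
    exact fun s hs => (hd s hs).differentiableAt.differentiableWithinAt
  · rw [interior_Ioi]
    intro s hs
    rw [(hd s hs).deriv]
    have h1 := (abs_le.1 (abs_energy_deriv_le (w := w) (w' := w') (κ := κ) s)).2
    nlinarith [mul_le_mul_of_nonneg_right h1 (Real.exp_pos (|κ| / s)).le]

theorem energy_mul_exp_monotoneOn (hw : ∀ s, 0 < s → HasDerivAt w (w' s) s)
    (hw' : ∀ s, 0 < s → HasDerivAt w' ((κ / s ^ 2 - 1) * w s) s) :
    MonotoneOn (fun s => (w s ^ 2 + w' s ^ 2) * Real.exp (-|κ| / s)) (Set.Ioi 0) := by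
  have hd : ∀ s, 0 < s → HasDerivAt (fun s => (w s ^ 2 + w' s ^ 2) * Real.exp (-|κ| / s)) _ s :=
    fun s hs => (hasDerivAt_energy (hw s hs) (hw' s hs)).mul (hasDerivAt_exp_div hs (-|κ|))
  refine monotoneOn_of_deriv_nonneg (convex_Ioi 0)
    (fun s hs => (hd s hs).continuousAt.continuousWithinAt) ?_ ?_
  · rw [interior_Ioi]
    exact fun s hs => (hd s hs).differentiableAt.differentiableWithinAt
  · rw [interior_Ioi]
    intro s hs
    rw [(hd s hs).deriv]
    have h1 := (abs_le.1 (abs_energy_deriv_le (w := w) (w' := w') (κ := κ) s)).1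
    calc 0 ≤ (2 * (κ / s ^ 2) * (w s * w' s) + |κ| / s ^ 2 * (w s ^ 2 + w' s ^ 2)) *
          Real.exp (-|κ| / s) := mul_nonneg (by linarith) (Real.exp_pos _).le
      _ = _ := by ring

theorem energy_le (hw : ∀ s, 0 < s → HasDerivAt w (w' s) s)
    (hw' : ∀ s, 0 < s → HasDerivAt w' ((κ / s ^ 2 - 1) * w s) s) {s : ℝ} (hs : 1 ≤ s) :
    w s ^ 2 + w' s ^ 2 ≤ (w 1 ^ 2 + w' 1 ^ 2) * Real.exp |κ| := by
  have h := energy_mul_exp_antitoneOn hw hw' (Set.mem_Ioi.2 one_pos)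
    (Set.mem_Ioi.2 (one_pos.trans_le hs)) hs
  simp only [div_one] at h
  refine le_trans ?_ h
  exact le_mul_of_one_le_right (by positivity) (Real.one_le_exp (by positivity))

/-- Solutions that are nonzero somewhere do not die out. This serves twice: it makes the limiting
amplitude positive and it rules out double zeros. -/
theorem le_energy (hw : ∀ s, 0 < s → HasDerivAt w (w' s) s)
    (hw' : ∀ s, 0 < s → HasDerivAt w' ((κ / s ^ 2 - 1) * w s) s) {s₀ s : ℝ} (hs₀ : 0 < s₀)
    (hs : s₀ ≤ s) :
    (w s₀ ^ 2 + w' s₀ ^ 2) * Real.exp (-|κ| / s₀) ≤ w s ^ 2 + w' s ^ 2 := by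
  have h := energy_mul_exp_monotoneOn hw hw' (Set.mem_Ioi.2 hs₀)
    (Set.mem_Ioi.2 (hs₀.trans_le hs)) hs
  refine le_trans h ?_
  refine mul_le_of_le_one_right (by positivity) (Real.exp_le_one_iff.2 ?_)
  have : 0 < s := hs₀.trans_le hs
  rw [neg_div]
  exact neg_nonpos.2 (by positivity)

theorem exists_tendsto_of_abs_deriv_le {f f' : ℝ → ℝ} {C : ℝ}
    (hf : ∀ s, 1 ≤ s → HasDerivAt f (f' s) s) (hc : ContinuousOn f' (Set.Ici 1))
    (hC : ∀ s, 1 ≤ s → |f' s| ≤ C / s ^ 2) : ∃ a, Tendsto f atTop (𝓝 a) := by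
  refine ⟨_, tendsto_limUnder_of_hasDerivAt_of_integrableOn_Ioi (a := 1) (f' := f')
    (fun s hs => hf s (le_of_lt hs)) ?_⟩
  have h2 : IntegrableOn (fun s : ℝ => C * s ^ (-2 : ℝ)) (Set.Ioi 1) :=
    (integrableOn_Ioi_rpow_of_lt (by norm_num) one_pos).const_mul C
  refine Integrable.mono' h2 ((hc.mono Set.Ioi_subset_Ici_self).aestronglyMeasurable
    measurableSet_Ioi) ?_
  filter_upwards [ae_restrict_mem measurableSet_Ioi] with s hs
  have hs0 : 0 < s := one_pos.trans hs
  rw [Real.rpow_neg hs0.le, ← div_eq_mul_inv]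
  exact_mod_cast hC s (le_of_lt hs)

/-- Variation of constants: rotating (w, w') back by the free flow gives two quantities that are
constant for κ = 0. Here their derivatives are O(1/s²), so they converge to limits a and b, and a² +
b² > 0 by `le_energy`. -/
theorem exists_tendsto_sub_mul_cos (hw : ∀ s, 0 < s → HasDerivAt w (w' s) s)
    (hw' : ∀ s, 0 < s → HasDerivAt w' ((κ / s ^ 2 - 1) * w s) s) {s₀ : ℝ} (hs₀ : 0 < s₀)
    (hne : w s₀ ≠ 0) :
    ∃ C θ : ℝ, 0 < C ∧ Tendsto (fun s => w s - C * Real.cos (s - θ)) atTop (𝓝 0) := by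
  set M := (w 1 ^ 2 + w' 1 ^ 2) * Real.exp |κ|
  have hwM : ∀ s, 1 ≤ s → |w s| ≤ √M := fun s hs =>
    Real.abs_le_sqrt ((le_add_of_nonneg_right (sq_nonneg _)).trans (energy_le hw hw' hs))
  have hbound : ∀ s g : ℝ, 1 ≤ s → |g| ≤ 1 → |κ / s ^ 2 * w s * g| ≤ |κ| * √M / s ^ 2 := by
    intro s g hs hg
    rw [abs_mul, abs_mul, abs_div, abs_of_nonneg (sq_nonneg s)]
    calc |κ| / s ^ 2 * |w s| * |g| ≤ |κ| / s ^ 2 * √M * 1 := by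
          gcongr
          exact hwM s hs
      _ = _ := by ring
  have hcw : ContinuousOn w (Set.Ici 1) := fun s hs =>
    (hw s (one_pos.trans_le hs)).continuousAt.continuousWithinAt
  have hpow : ∀ s ∈ Set.Ici (1 : ℝ), s ^ 2 ≠ 0 := fun s hs =>
    pow_ne_zero _ (one_pos.trans_le hs).ne'
  obtain ⟨a, ha⟩ := exists_tendsto_of_abs_deriv_le
    (f := fun s => w s * Real.cos s - w' s * Real.sin s)
    (f' := fun s => κ / s ^ 2 * w s * -Real.sin s)
    (fun s hs => by
      have h0 := one_pos.trans_le hs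
      refine (((hw s h0).mul (Real.hasDerivAt_cos s)).sub
        ((hw' s h0).mul (Real.hasDerivAt_sin s))).congr_deriv ?_
      ring)
    (by fun_prop (disch := assumption))
    (fun s hs => hbound s _ hs (by rw [abs_neg]; exact Real.abs_sin_le_one s))
  obtain ⟨b, hb⟩ := exists_tendsto_of_abs_deriv_le
    (f := fun s => w s * Real.sin s + w' s * Real.cos s)
    (f' := fun s => κ / s ^ 2 * w s * Real.cos s)
    (fun s hs => by
      have h0 := one_pos.trans_le hs
      refine (((hw s h0).mul (Real.hasDerivAt_sin s)).add
        ((hw' s h0).mul (Real.hasDerivAt_cos s))).congr_deriv ?_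
      ring)
    (by fun_prop (disch := assumption))
    (fun s hs => hbound s _ hs (Real.abs_cos_le_one s))
  have hpos : 0 < a ^ 2 + b ^ 2 := by
    have hlim := (ha.pow 2).add (hb.pow 2)
    have h0 : 0 < (w s₀ ^ 2 + w' s₀ ^ 2) * Real.exp (-|κ| / s₀) := by positivity
    refine h0.trans_le (ge_of_tendsto hlim ?_)
    filter_upwards [eventually_ge_atTop s₀] with s hs
    refine (le_energy hw hw' hs₀ hs).trans (le_of_eq ?_)
    linear_combination (-(w s ^ 2 + w' s ^ 2)) * Real.sin_sq_add_cos_sq s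
  -- Amplitude and phase are the polar coordinates of a + ib: a cos s + b sin s = |z| cos(s - arg
  -- z).
  set z : ℂ := ⟨a, b⟩
  have hz : z ≠ 0 := by
    intro h
    have h1 : a = 0 := congrArg Complex.re h
    have h2 : b = 0 := congrArg Complex.im h
    simp [h1, h2] at hpos
  refine ⟨‖z‖, Complex.arg z, norm_pos_iff.2 hz, ?_⟩
  have hlim : Tendsto (fun s => (w s * Real.cos s - w' s * Real.sin s - a) * Real.cos s +
      (w s * Real.sin s + w' s * Real.cos s - b) * Real.sin s) atTop (𝓝 (0 + 0)) := by
    refine Tendsto.add ?_ ?_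
    · refine Tendsto.zero_mul_isBoundedUnder_le (by simpa using ha.sub_const a) ?_
      exact isBoundedUnder_of ⟨1, fun s => Real.abs_cos_le_one s⟩
    · refine Tendsto.zero_mul_isBoundedUnder_le (by simpa using hb.sub_const b) ?_
      exact isBoundedUnder_of ⟨1, fun s => Real.abs_sin_le_one s⟩
  rw [add_zero] at hlim
  refine hlim.congr fun s => ?_
  have h1 : ‖z‖ * Real.cos z.arg = a := Complex.norm_mul_cos_arg z
  have h2 : ‖z‖ * Real.sin z.arg = b := Complex.norm_mul_sin_arg z
  rw [Real.cos_sub]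
  linear_combination w s * Real.sin_sq_add_cos_sq s + Real.cos s * h1 + Real.sin s * h2

end PerturbedOscillator

/-! ### Decay, oscillation and zeros of the radial profile. -/

section SphereProfileAsymptotics

open Topology

variable (N : ℕ) [NeZero N]

/-- The derivative of `sphereProfile`. -/
noncomputable def sphereProfileDeriv (s : ℝ) : ℝ :=
  ∫ y, -(y 0 * Real.sin (s * y 0)) ∂unitSphereMeasure N

/-- The radial profile, rescaled so that it oscillates with constant amplitude at infinity. -/
noncomputable def scaledProfile (s : ℝ) : ℝ :=
  s ^ (((N : ℝ) - 1) / 2) * sphereProfile N s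

/-- The derivative of `scaledProfile`. -/
noncomputable def scaledProfileDeriv (s : ℝ) : ℝ :=
  ((N : ℝ) - 1) / 2 * s ^ (((N : ℝ) - 1) / 2 - 1) * sphereProfile N s +
    s ^ (((N : ℝ) - 1) / 2) * sphereProfileDeriv N s

theorem hasDerivAt_scaledProfile {s : ℝ} (hs : 0 < s) :
    HasDerivAt (scaledProfile N) (scaledProfileDeriv N s) s :=
  (Real.hasDerivAt_rpow_const (Or.inl hs.ne')).mul (hasDerivAt_sphereProfile s)

/-- The exponent (N-1)/2 is the one for which the first-order term of Bessel's equation cancels. -/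
theorem hasDerivAt_scaledProfileDeriv {s : ℝ} (hs : 0 < s) :
    HasDerivAt (scaledProfileDeriv N)
      ((((N : ℝ) - 1) / 2 * (((N : ℝ) - 1) / 2 - 1) / s ^ 2 - 1) * scaledProfile N s) s := by
  have h := (((Real.hasDerivAt_rpow_const (p := ((N : ℝ) - 1) / 2 - 1) (Or.inl hs.ne')).const_mul
    (((N : ℝ) - 1) / 2)).mul (hasDerivAt_sphereProfile (N := N) s)).add
    ((Real.hasDerivAt_rpow_const (p := ((N : ℝ) - 1) / 2) (Or.inl hs.ne')).mul
      (hasDerivAt_sphereProfile_deriv (N := N) s))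
  refine h.congr_deriv ?_
  have ode := sphereProfile_ode (N := N) s
  simp only [Real.rpow_sub_one hs.ne', scaledProfile]
  set φ := sphereProfile N s
  set φ₁ := ∫ y, -(y 0 * Real.sin (s * y 0)) ∂unitSphereMeasure N
  set φ₂ := ∫ y, -(y 0 ^ 2 * Real.cos (s * y 0)) ∂unitSphereMeasure N
  set p := s ^ (((N : ℝ) - 1) / 2)
  have ode' : φ₂ = -((N : ℝ) - 1) / s * φ₁ - φ := by
    field_simp
    linear_combination ode
  rw [ode']
  field_simp
  ring

theorem exists_pos_lt_sphereProfile_ne_zero {s : ℝ} (hs : 0 < s) :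
    ∃ s₀, 0 < s₀ ∧ s₀ < s ∧ sphereProfile N s₀ ≠ 0 := by
  have hc : ContinuousAt (sphereProfile N) 0 := (hasDerivAt_sphereProfile 0).continuousAt
  have h1 : ∀ᶠ t in 𝓝[>] (0 : ℝ), sphereProfile N t ≠ 0 :=
    (hc.eventually_ne (by simp [sphereProfile_zero])).filter_mono nhdsWithin_le_nhds
  have h2 : ∀ᶠ t in 𝓝[>] (0 : ℝ), t ∈ Set.Ioo 0 s := Ioo_mem_nhdsGT hs
  obtain ⟨t, ht, ht'⟩ := (h1.and h2).exists
  exact ⟨t, ht'.1, ht'.2, ht⟩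

/-- At a double zero the energy of the scaled profile would vanish, although it is positive at some
smaller s₀ near 0, where the profile is close to 1. -/
theorem eventually_sphereProfile_ne_zero {s : ℝ} (hs : 0 < s) :
    ∀ᶠ t in 𝓝[≠] s, sphereProfile N t ≠ 0 := by
  by_cases h0 : sphereProfile N s = 0
  · refine (hasDerivAt_sphereProfile s).eventually_ne (c := 0) fun hd => ?_
    obtain ⟨s₀, hs₀, hlt, hne⟩ := exists_pos_lt_sphereProfile_ne_zero N hs
    have h := le_energy (fun s hs => hasDerivAt_scaledProfile N hs)
      (fun s hs => hasDerivAt_scaledProfileDeriv N hs) hs₀ hlt.le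
    have hz : scaledProfile N s = 0 := by simp [scaledProfile, h0]
    have hz' : scaledProfileDeriv N s = 0 := by
      simp only [scaledProfileDeriv, h0, sphereProfileDeriv, hd]
      simp
    have hpos : scaledProfile N s₀ ≠ 0 := mul_ne_zero (Real.rpow_pos_of_pos hs₀ _).ne' hne
    rw [hz, hz'] at h
    have : 0 < (scaledProfile N s₀ ^ 2 + scaledProfileDeriv N s₀ ^ 2) *
      Real.exp (-|((N : ℝ) - 1) / 2 * (((N : ℝ) - 1) / 2 - 1)| / s₀) := by positivity
    rw [zero_pow two_ne_zero, add_zero] at h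
    exact absurd h (not_le.2 this)
  · exact ((hasDerivAt_sphereProfile s).continuousAt.eventually_ne h0).filter_mono
      nhdsWithin_le_nhds

theorem exists_abs_sphereProfile_le :
    ∃ C, 0 < C ∧ ∀ s, 0 ≤ s → |sphereProfile N s| ≤ C * (1 + s) ^ (-(((N : ℝ) - 1) / 2)) := by
  have hα : 0 ≤ ((N : ℝ) - 1) / 2 := by
    have : (1 : ℝ) ≤ N := by exact_mod_cast NeZero.one_le
    linarith
  set α := ((N : ℝ) - 1) / 2 with hαdef
  set M := (scaledProfile N 1 ^ 2 + scaledProfileDeriv N 1 ^ 2) * Real.exp |α * (α - 1)|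
  have hM : ∀ s, 1 ≤ s → |scaledProfile N s| ≤ √M := fun s hs =>
    Real.abs_le_sqrt ((le_add_of_nonneg_right (sq_nonneg _)).trans
      (energy_le (fun s hs => hasDerivAt_scaledProfile N hs)
        (fun s hs => hasDerivAt_scaledProfileDeriv N hs) hs))
  -- The factor 2^α pays for 1 + s in place of s: 1 + s ≤ 2 for s ≤ 1, and 1 + s ≤ 2s for s ≥ 1.
  refine ⟨max 1 √M * 2 ^ α, by positivity, fun s hs => ?_⟩
  rcases le_total s 1 with h1 | h1
  · refine (abs_sphereProfile_le_one s).trans ?_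
    rw [Real.rpow_neg (by positivity), mul_assoc, ← div_eq_mul_inv,
      ← Real.div_rpow (by norm_num) (by positivity)]
    have h2 : 1 ≤ (2 / (1 + s)) ^ α :=
      Real.one_le_rpow ((one_le_div (by positivity)).2 (by linarith)) hα
    exact one_le_mul_of_one_le_of_one_le (le_max_left _ _) h2
  · have hs0 : 0 < s := one_pos.trans_le h1
    have hp : 0 < s ^ α := Real.rpow_pos_of_pos hs0 _
    have h3 : |sphereProfile N s| = |scaledProfile N s| * s ^ (-α) := by
      rw [scaledProfile, abs_mul, abs_of_pos hp, Real.rpow_neg hs]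
      field_simp
    rw [h3, mul_assoc]
    have h4 : s ^ (-α) ≤ 2 ^ α * (1 + s) ^ (-α) := by
      rw [Real.rpow_neg hs, Real.rpow_neg (by positivity), ← div_eq_mul_inv, le_div_iff₀ (by positivity),
        inv_mul_le_iff₀ hp, mul_comm, ← Real.mul_rpow (by norm_num) hs]
      exact Real.rpow_le_rpow (by positivity) (by linarith) hα
    exact mul_le_mul ((hM s h1).trans (le_max_right _ _)) h4 (by positivity) (by positivity)

/-- Take s with a s - θ ∈ πℤ, so that the first cosine is ±1. Between two consecutive such s the
second phase moves by πb/a. If b < a its sine is positive, and |cos y| + |cos y'| ≥ sin(y' - y)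
shows that one of the two candidates works. -/
theorem exists_delta_le_abs_cos_mul_sub {a b : ℝ} (hb : 0 < b) (hba : b ≤ a) (θ : ℝ) :
    ∃ δ, 0 < δ ∧ ∀ ρ, ∃ s, ρ ≤ s ∧ s ≤ ρ + 2 * Real.pi / a ∧
      δ ≤ |Real.cos (a * s - θ)| ∧ δ ≤ |Real.cos (b * s - θ)| := by
  have ha : 0 < a := hb.trans_le hba
  have hπ := Real.pi_pos
  -- The two candidates i = 0, 1 lie in the window: rounding up costs less than π in the phase, and
  -- passing to i = 1 costs another π.
  have key : ∀ (ρ : ℝ) (i : ℝ), i = 0 ∨ i = 1 →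
      ρ ≤ ((⌈(a * ρ - θ) / Real.pi⌉ + i) * Real.pi + θ) / a ∧
      ((⌈(a * ρ - θ) / Real.pi⌉ + i) * Real.pi + θ) / a ≤ ρ + 2 * Real.pi / a := by
    intro ρ i hi
    have h1 := (div_le_iff₀ hπ).1 (Int.le_ceil ((a * ρ - θ) / Real.pi))
    have h2 := (lt_div_iff₀ hπ).1 (sub_lt_iff_lt_add.2 (Int.ceil_lt_add_one ((a * ρ - θ) / Real.pi)))
    have h3 : ρ + 2 * Real.pi / a = (a * ρ + 2 * Real.pi) / a := by field_simp
    rw [h3, le_div_iff₀ ha]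
    refine ⟨?_, div_le_div_of_nonneg_right ?_ ha.le⟩ <;> rcases hi with rfl | rfl <;> linarith
  have hcos : ∀ (j : ℤ) , |Real.cos (a * ((j * Real.pi + θ) / a) - θ)| = 1 := by
    intro j
    rw [mul_div_cancel₀ _ ha.ne', add_sub_cancel_right, Real.abs_cos_int_mul_pi]
  rcases hba.eq_or_lt with rfl | hlt
  · refine ⟨1, one_pos, fun ρ => ⟨_, (key ρ 0 (Or.inl rfl)).1, (key ρ 0 (Or.inl rfl)).2, ?_, ?_⟩⟩ <;>
      rw [add_zero, hcos]
  · have hβ : 0 < Real.sin (Real.pi * (b / a)) := by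
      refine Real.sin_pos_of_pos_of_lt_pi (by positivity) ?_
      exact mul_lt_of_lt_one_right hπ ((div_lt_one ha).2 hlt)
    refine ⟨Real.sin (Real.pi * (b / a)) / 2, by positivity, fun ρ => ?_⟩
    set j := ⌈(a * ρ - θ) / Real.pi⌉
    have hle : Real.sin (Real.pi * (b / a)) / 2 ≤ 1 := by
      linarith [Real.sin_le_one (Real.pi * (b / a))]
    set y := b * (((j + 0 : ℝ) * Real.pi + θ) / a) - θ
    set y' := b * (((j + 1 : ℝ) * Real.pi + θ) / a) - θ
    have hsin : Real.sin (Real.pi * (b / a)) ≤ |Real.cos y| + |Real.cos y'| := by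
      have e : Real.pi * (b / a) = y' - y := by
        simp only [y, y']
        field_simp
        ring
      rw [e, Real.sin_sub]
      calc Real.sin y' * Real.cos y - Real.cos y' * Real.sin y
          ≤ |Real.sin y' * Real.cos y - Real.cos y' * Real.sin y| := le_abs_self _
        _ ≤ |Real.sin y'| * |Real.cos y| + |Real.cos y'| * |Real.sin y| := by
          rw [← abs_mul, ← abs_mul]
          exact abs_sub _ _
        _ ≤ 1 * |Real.cos y| + |Real.cos y'| * 1 := by
          gcongr
          exacts [Real.abs_sin_le_one _, Real.abs_sin_le_one _]
        _ = _ := by ring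
    by_cases hy : Real.sin (Real.pi * (b / a)) / 2 ≤ |Real.cos y|
    · refine ⟨_, (key ρ 0 (Or.inl rfl)).1, (key ρ 0 (Or.inl rfl)).2, ?_, hy⟩
      rw [add_zero, hcos]
      exact hle
    · refine ⟨_, (key ρ 1 (Or.inr rfl)).1, (key ρ 1 (Or.inr rfl)).2, ?_, ?_⟩
      · have := hcos (j + 1)
        push_cast at this
        rw [this]
        exact hle
      · change _ ≤ |Real.cos y'|
        linarith

theorem exists_le_abs_sphereProfile_mul {a b : ℝ} (hb : 0 < b) (hba : b ≤ a) (n : ℕ) :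
    ∃ A, 0 < A ∧ ∀ᶠ ρ in atTop, ∃ s, ρ ≤ s ∧
      A * ρ ^ (-(((n : ℝ) + 1) * (((N : ℝ) - 1) / 2))) ≤
        |sphereProfile N (a * s)| ^ n * |sphereProfile N (b * s)| := by
  have ha : 0 < a := hb.trans_le hba
  have hα : 0 ≤ ((N : ℝ) - 1) / 2 := by
    have : (1 : ℝ) ≤ N := by exact_mod_cast NeZero.one_le
    linarith
  obtain ⟨s₀, hs₀, -, hne⟩ := exists_pos_lt_sphereProfile_ne_zero N one_pos
  obtain ⟨C, θ, hC, hlim⟩ := exists_tendsto_sub_mul_cos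
    (fun s hs => hasDerivAt_scaledProfile N hs)
    (fun s hs => hasDerivAt_scaledProfileDeriv N hs) hs₀
    (mul_ne_zero (Real.rpow_pos_of_pos hs₀ _).ne' hne)
  obtain ⟨δ, hδ, hcos⟩ := exists_delta_le_abs_cos_mul_sub hb hba θ
  set α := ((N : ℝ) - 1) / 2 with hαdef
  have hCδ : 0 < C * δ / 2 := by positivity
  have hev : ∀ᶠ x in atTop, |scaledProfile N x - C * Real.cos (x - θ)| < C * δ / 2 := by
    have := (Metric.tendsto_nhds.1 hlim) _ hCδ
    simpa [Real.dist_eq] using this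
  obtain ⟨X, hX⟩ := eventually_atTop.1 hev
  have hlow : ∀ x, max X 1 ≤ x → δ ≤ |Real.cos (x - θ)| →
      C * δ / 2 * x ^ (-α) ≤ |sphereProfile N x| := by
    intro x hx hx'
    have hx0 : 0 < x := one_pos.trans_le ((le_max_right _ _).trans hx)
    have h1 := hX x ((le_max_left _ _).trans hx)
    have h2 : C * δ ≤ |C * Real.cos (x - θ)| := by
      rw [abs_mul, abs_of_pos hC]
      gcongr
    have h3 := abs_sub_abs_le_abs_sub (C * Real.cos (x - θ)) (scaledProfile N x)
    rw [abs_sub_comm] at h3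
    have h4 : C * δ / 2 ≤ |scaledProfile N x| := by linarith
    rw [scaledProfile, abs_mul, abs_of_pos (Real.rpow_pos_of_pos hx0 _)] at h4
    rw [Real.rpow_neg hx0.le, ← div_eq_mul_inv, div_le_iff₀ (Real.rpow_pos_of_pos hx0 _)]
    linarith
  -- For ρ ≥ 2π/a the window gives b s ≤ a s ≤ 2aρ, so each of the n + 1 factors is at least
  -- (Cδ/2)(2aρ)^(-α).
  refine ⟨(C * δ / 2) ^ (n + 1) * (2 * a) ^ (-(((n : ℝ) + 1) * α)), by positivity, ?_⟩
  filter_upwards [eventually_ge_atTop (max X 1 / b), eventually_ge_atTop (2 * Real.pi / a),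
    eventually_gt_atTop 0] with ρ h1 h2 h3
  obtain ⟨s, hs1, hs2, hs3, hs4⟩ := hcos ρ
  refine ⟨s, hs1, ?_⟩
  have hs0 : 0 < s := h3.trans_le hs1
  have hbs : max X 1 ≤ b * s := by
    rw [div_le_iff₀ hb] at h1
    nlinarith
  have hbas : b * s ≤ a * s := by gcongr
  have hA := hlow (a * s) (hbs.trans hbas) hs3
  have hB := hlow (b * s) hbs hs4
  have hbs' : (a * s) ^ (-α) ≤ (b * s) ^ (-α) :=
    Real.rpow_le_rpow_of_nonpos (by positivity) hbas (by linarith)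
  have has : (2 * a * ρ) ^ (-α) ≤ (a * s) ^ (-α) :=
    Real.rpow_le_rpow_of_nonpos (by positivity) (by nlinarith) (by linarith)
  have hpos : 0 ≤ (2 * a * ρ) ^ (-α) := by positivity
  calc (C * δ / 2) ^ (n + 1) * (2 * a) ^ (-(((n : ℝ) + 1) * α)) * ρ ^ (-(((n : ℝ) + 1) * α))
      = (C * δ / 2 * (2 * a * ρ) ^ (-α)) ^ n * (C * δ / 2 * (2 * a * ρ) ^ (-α)) := by
        rw [← pow_succ, mul_pow, ← Real.rpow_mul_natCast (by positivity), mul_assoc,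
          ← Real.mul_rpow (by positivity) h3.le]
        congr 2
        push_cast
        ring
    _ ≤ |sphereProfile N (a * s)| ^ n * |sphereProfile N (b * s)| := by
        gcongr
        · exact (mul_le_mul_of_nonneg_left has hCδ.le).trans hA
        · exact (mul_le_mul_of_nonneg_left (has.trans hbs') hCδ.le).trans hB

end SphereProfileAsymptotics

/-! ### Plancherel's identity for the integral Fourier transform on L¹ ∩ L². -/

section Plancherel

open FourierTransform SchwartzMap
open scoped ContDiff

variable {E : Type*} [NormedAddCommGroup E] [InnerProductSpace ℝ E] [FiniteDimensional ℝ E]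
  [MeasurableSpace E] [BorelSpace E]

/-- Both transforms satisfy the multiplication formula ∫ 𝓕ψ · f = ∫ ψ · 𝓕f for Schwartz ψ, so they
agree against all smooth compactly supported test functions. -/
theorem MeasureTheory.MemLp.fourier_toLp_ae_eq {f : E → ℂ} (hf1 : Integrable f)
    (hf2 : MemLp f 2) : ⇑(𝓕 (hf2.toLp f) : Lp ℂ 2 (volume : Measure E)) =ᵐ[volume] 𝓕 f := by
  have hcont : Continuous (𝓕 f) :=
    VectorFourier.fourierIntegral_continuous Real.continuous_fourierChar
      (by exact continuous_inner) hf1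
  refine ae_eq_of_integral_contDiff_smul_eq
    ((Lp.memLp (𝓕 (hf2.toLp f) : Lp ℂ 2 (volume : Measure E))).locallyIntegrable (by norm_num)) hcont.locallyIntegrable ?_
  intro g hg hgc
  have hg1 : HasCompactSupport (Complex.ofRealCLM ∘ g) := hgc.comp_left rfl
  have hg2 : ContDiff ℝ ∞ (Complex.ofRealCLM ∘ g) := by fun_prop
  set ψ : 𝓢(E, ℂ) := hg1.toSchwartzMap hg2
  have hψ : ∀ x, ψ x = (g x : ℂ) := fun x => by simp [ψ]
  have h1 : ∫ x, g x • (𝓕 (hf2.toLp f) : Lp ℂ 2 (volume : Measure E)) x =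
      Lp.toTemperedDistribution (𝓕 (hf2.toLp f)) ψ := by
    rw [Lp.toTemperedDistribution_apply]
    simp [hψ]
  have h2 : ∫ x, g x • (𝓕 f) x = ∫ x, ψ x • (𝓕 f) x := by simp [hψ]
  rw [h1, h2, ← Lp.fourier_toTemperedDistribution_eq, TemperedDistribution.fourier_apply,
    Lp.toTemperedDistribution_apply]
  have h3 : ∫ x, (𝓕 ψ) x • (hf2.toLp f) x = ∫ x, (𝓕 ψ) x • f x := by
    refine integral_congr_ae ?_
    filter_upwards [hf2.coeFn_toLp] with x hx
    rw [hx]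
  rw [h3]
  have := VectorFourier.integral_fourierIntegral_smul_eq_flip (L := innerₗ E)
    Real.continuous_fourierChar continuous_inner (ψ.integrable (μ := volume)) hf1
  rw [flip_innerₗ] at this
  exact this

theorem eLpNorm_fourier_eq {f : E → ℂ} (hf1 : Integrable f) (hf2 : MemLp f 2) :
    eLpNorm (𝓕 f) 2 volume = eLpNorm f 2 volume := by
  rw [← eLpNorm_congr_ae (MemLp.fourier_toLp_ae_eq hf1 hf2), ← eLpNorm_congr_ae hf2.coeFn_toLp,
    ← Lp.enorm_def, ← Lp.enorm_def, ← ofReal_norm, Lp.norm_fourier_eq, ofReal_norm]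

end Plancherel

/-! ### Hilbert–Schmidt operators, and compact embeddings. -/

section HilbertSchmidt

open Topology

variable {𝕜 H K ι : Type*} [RCLike 𝕜] [NormedAddCommGroup H] [InnerProductSpace 𝕜 H]
  [NormedAddCommGroup K] [NormedSpace 𝕜 K]

theorem isCompactOperator_smulRight (f : H →L[𝕜] 𝕜) (x : K) :
    IsCompactOperator (f.smulRight x) := by
  have hf : IsCompactOperator f := isCompactOperator_of_locallyCompactSpace_dom f
  exact hf.clm_comp (ContinuousLinearMap.toSpanSingleton 𝕜 x)

/-- Hilbert–Schmidt operators are compact. -/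
theorem HilbertBasis.isCompactOperator_of_sum_sq_le [CompleteSpace K] (b : HilbertBasis ι 𝕜 H)
    (F : H →L[𝕜] K) {C : ℝ} (hC : ∀ s : Finset ι, ∑ i ∈ s, ‖F (b i)‖ ^ 2 ≤ C) :
    IsCompactOperator F := by
  classical
  have hsum : Summable fun i => ‖F (b i)‖ ^ 2 :=
    summable_of_sum_le (fun i => sq_nonneg _) hC
  set G : Finset ι → (H →L[𝕜] K) := fun s => ∑ i ∈ s, (innerSL 𝕜 (b i)).smulRight (F (b i))
  have hG : ∀ s, IsCompactOperator (G s) := fun s =>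
    (compactOperator (RingHom.id 𝕜) H K).sum_mem fun i _ => isCompactOperator_smulRight _ _
  have hGapp : ∀ s u, G s u = ∑ i ∈ s, (inner 𝕜 (b i) u) • F (b i) := by
    intro s u
    simp [G]
  have htend : ∀ u, Tendsto (fun t => G t u) atTop (𝓝 (F u)) := by
    intro u
    have h1 : HasSum (fun i => F ((b.repr u i) • b i)) (F u) := (b.hasSum_repr u).mapL F
    have h2 : Tendsto (fun t : Finset ι => ∑ i ∈ t, F ((b.repr u i) • b i)) atTop (𝓝 (F u)) := h1
    refine h2.congr fun t => ?_
    rw [hGapp]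
    exact Finset.sum_congr rfl fun i _ => by rw [map_smul, b.repr_apply_apply]
  set S := ∑' i, ‖F (b i)‖ ^ 2
  -- The finite-rank truncations G s converge in norm: Cauchy–Schwarz and Bessel bound G t - G s for
  -- t ⊇ s by the tail of the series, and t → ∞ replaces G t by F.
  have hbound : ∀ s, ‖G s - F‖ ≤ √(S - ∑ i ∈ s, ‖F (b i)‖ ^ 2) := by
    intro s
    refine ContinuousLinearMap.opNorm_le_bound _ (Real.sqrt_nonneg _) fun u => ?_
    rw [_root_.sub_apply, norm_sub_rev]
    refine le_of_tendsto (((htend u).sub_const (G s u)).norm) ?_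
    filter_upwards [eventually_ge_atTop s] with t hst
    have hle : ∑ i ∈ t \ s, ‖F (b i)‖ ^ 2 ≤ S - ∑ i ∈ s, ‖F (b i)‖ ^ 2 := by
      rw [le_sub_iff_add_le, Finset.sum_sdiff hst]
      exact hsum.sum_le_tsum _ fun i _ => sq_nonneg _
    rw [hGapp, hGapp, ← Finset.sum_sdiff hst, add_sub_cancel_right]
    calc ‖∑ i ∈ t \ s, inner 𝕜 (b i) u • F (b i)‖
        ≤ ∑ i ∈ t \ s, ‖inner 𝕜 (b i) u‖ * ‖F (b i)‖ :=
          (norm_sum_le _ _).trans (Finset.sum_le_sum fun i _ => (norm_smul _ _).le)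
      _ ≤ √(∑ i ∈ t \ s, ‖inner 𝕜 (b i) u‖ ^ 2) * √(∑ i ∈ t \ s, ‖F (b i)‖ ^ 2) :=
          Real.sum_mul_le_sqrt_mul_sqrt _ _ _
      _ ≤ √(‖u‖ ^ 2) * √(S - ∑ i ∈ s, ‖F (b i)‖ ^ 2) := by
          gcongr
          exact b.orthonormal.sum_inner_products_le u
      _ = √(S - ∑ i ∈ s, ‖F (b i)‖ ^ 2) * ‖u‖ := by
          rw [Real.sqrt_sq (norm_nonneg u), mul_comm]
  refine isCompactOperator_of_tendsto (l := atTop) (F := G) (f := F) ?_ (Eventually.of_forall hG)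
  rw [tendsto_iff_norm_sub_tendsto_zero]
  refine squeeze_zero (fun s => norm_nonneg _) hbound ?_
  have h3 : Tendsto (fun s : Finset ι => S - ∑ i ∈ s, ‖F (b i)‖ ^ 2) atTop (𝓝 (S - S)) :=
    tendsto_const_nhds.sub hsum.hasSum
  rw [sub_self] at h3
  simpa using h3.sqrt

/-- A linear embedding is bounded below, hence by completeness a closed embedding. The unit ball
then lies in the preimage of a compact set, which is compact, and Riesz's theorem applies. -/
theorem finiteDimensional_of_isCompactOperator_of_isEmbedding [CompleteSpace H]
    {F : H →L[𝕜] K} (hF : IsCompactOperator F) (he : IsEmbedding F) : FiniteDimensional 𝕜 H := by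
  obtain ⟨c, hc⟩ := LinearMap.antilipschitz_of_comap_nhds_le (F : H →ₗ[𝕜] K)
    (by
      have := he.nhds_eq_comap 0
      rw [map_zero] at this
      exact this.ge)
  have hcl : IsClosedEmbedding F := hc.isClosedEmbedding F.uniformContinuous
  obtain ⟨L, hL, hsub⟩ := hF.image_closedBall_subset_compact (f := (F : H →ₗ[𝕜] K)) 1
  refine FiniteDimensional.of_isCompact_closedBall₀ 𝕜 one_pos ?_
  exact (hcl.isCompact_preimage hL).of_isClosed_subset isClosed_closedBall
    (Set.image_subset_iff.1 hsub)

end HilbertSchmidt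

/-! ### L² of a nonempty open set is infinite-dimensional. -/

section InfiniteDimensional

variable {𝕜 : Type*} [RCLike 𝕜] {N : ℕ} [NeZero N]

theorem not_finiteDimensional_Lp_two_restrict {Ω : Set (EuclideanSpace ℝ (Fin N))}
    (hopen : IsOpen Ω) (hne : Ω.Nonempty) :
    ¬ FiniteDimensional 𝕜 (Lp 𝕜 2 ((volume : Measure (EuclideanSpace ℝ (Fin N))).restrict Ω)) := by
  intro hfin
  obtain ⟨x, hx⟩ := hne
  obtain ⟨ε, hε, hball⟩ := Metric.isOpen_iff.1 hopen x hx
  -- Disjoint open annuli around x inside Ω; their indicators are nonzero and pairwise orthogonal.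
  set A : ℕ → Set (EuclideanSpace ℝ (Fin N)) := fun n =>
    {y | ε / (n + 2) < dist y x ∧ dist y x < ε / (n + 1)}
  have hAopen : ∀ n, IsOpen (A n) := fun n =>
    IsOpen.inter (s := {y | ε / (n + 2) < dist y x}) (t := {y | dist y x < ε / (n + 1)})
      (isOpen_lt (by fun_prop) (by fun_prop)) (isOpen_lt (by fun_prop) (by fun_prop))
  have hAball : ∀ n, A n ⊆ ball x ε := by
    rintro n y ⟨-, hy⟩
    refine mem_ball.2 (hy.trans_le (div_le_self hε.le ?_))
    linarith [(Nat.cast_nonneg n : (0 : ℝ) ≤ n)]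
  have hAne : ∀ n, (A n).Nonempty := by
    intro n
    have hlt : ε / ((n : ℝ) + 2) < ε / (n + 1) := by
      gcongr
      norm_num
    obtain ⟨t, ht1, ht2⟩ := exists_between hlt
    have ht0 : 0 < t := lt_trans (by positivity) ht1
    refine ⟨x + t • EuclideanSpace.single 0 1, ?_⟩
    simp only [A, Set.mem_ofPred_eq, dist_eq_norm, add_sub_cancel_left, norm_smul,
      PiLp.norm_single, norm_one, mul_one, Real.norm_of_nonneg ht0.le]
    exact ⟨ht1, ht2⟩
  have hdisj : ∀ m n, m < n → Disjoint (A m) (A n) := by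
    intro m n hmn
    rw [Set.disjoint_left]
    rintro y ⟨h1, -⟩ ⟨-, h2⟩
    have h3 : ε / ((n : ℝ) + 1) ≤ ε / (m + 2) := by
      have : (m : ℝ) + 1 ≤ n := by exact_mod_cast hmn
      exact div_le_div_of_nonneg_left hε.le (by positivity) (by linarith)
    linarith
  have hμ : ∀ n, (volume.restrict Ω) (A n) = volume (A n) := fun n =>
    Measure.restrict_eq_self _ ((hAball n).trans hball)
  have hfinite : ∀ n, (volume.restrict Ω) (A n) ≠ ⊤ := fun n => by
    rw [hμ]
    exact (measure_mono (hAball n)).trans_lt measure_ball_lt_top |>.ne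
  set f : ℕ → Lp 𝕜 2 (volume.restrict Ω) := fun n =>
    indicatorConstLp 2 (hAopen n).measurableSet (hfinite n) (1 : 𝕜)
  have hli : LinearIndependent 𝕜 f := by
    refine linearIndependent_of_ne_zero_of_inner_eq_zero (fun n hn => ?_) fun m n hmn => ?_
    · have h1 : ‖f n‖ = 0 := by rw [hn, norm_zero]
      rw [norm_indicatorConstLp two_ne_zero ENNReal.ofNat_ne_top, norm_one, one_mul] at h1
      have hpos : 0 < (volume.restrict Ω).real (A n) := by
        rw [Measure.real, hμ]
        exact ENNReal.toReal_pos ((hAopen n).measure_pos volume (hAne n)).ne'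
          (by rw [← hμ]; exact hfinite n)
      exact (Real.rpow_pos_of_pos hpos _).ne' h1
    · change inner 𝕜 (f m) (f n) = 0
      rw [L2.inner_indicatorConstLp_indicatorConstLp _ _ (hfinite m) (hfinite n)]
      have hd : Disjoint (A m) (A n) := by
        rcases lt_or_gt_of_ne hmn with h | h
        · exact hdisj m n h
        · exact (hdisj n m h).symm
      simp [hd.inter_eq]
  exact Module.Finite.not_linearIndependent_of_infinite f hli

end InfiniteDimensional

theorem not_isBigO_rpow_exp_neg_mul_rpow (p : ℝ) {a b : ℝ} (ha : 0 < a) (hb : 0 < b) :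
    ¬ (fun k : ℝ => k ^ p) =O[atTop] fun k : ℝ => Real.exp (-a * k ^ b) := by
  intro h
  have h1 : (fun k : ℝ => Real.exp (-a * k ^ b)) =o[atTop] fun k : ℝ => (k ^ b) ^ (p / b) :=
    (isLittleO_exp_neg_mul_rpow_atTop ha (p / b)).comp_tendsto (tendsto_rpow_atTop hb)
  have h2 : (fun k : ℝ => (k ^ b) ^ (p / b)) =ᶠ[atTop] fun k : ℝ => k ^ p := by
    filter_upwards [eventually_ge_atTop 0] with k hk
    rw [← Real.rpow_mul hk, mul_div_cancel₀ _ hb.ne']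
  have h3 := h.trans_isLittleO (h1.trans_eventuallyEq h2)
  refine isLittleO_irrefl (Eventually.frequently ?_) h3
  filter_upwards [eventually_gt_atTop 0] with k hk
  exact (Real.rpow_pos_of_pos hk p).ne'

theorem eLpNorm_two_sq_eq_lintegral {α V : Type*} [MeasurableSpace α] [NormedAddCommGroup V]
    (m : Measure α) (g : α → V) : eLpNorm g 2 m ^ 2 = ∫⁻ x, ‖g x‖ₑ ^ 2 ∂m := by
  have := eLpNorm_nnreal_pow_eq_lintegral (μ := m) (f := g) (p := 2) two_ne_zero
  simpa using this

/-! ### Convolution of a probability measure with a function. -/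

section MeasureConvolution

variable {E β V : Type*} [NormedAddCommGroup E] [MeasurableSpace E]

section Basic

variable [NormedAddCommGroup V] [NormedSpace ℝ V]

/-- The convolution of a measure and a function. -/
noncomputable def measureConvolution (μ : Measure E) (f : E → V) (x : E) : V :=
  ∫ y, f (x - y) ∂μ

variable {μ : Measure E} {f : E → V}

theorem measureConvolution_const_smul {𝕜 : Type*} [RCLike 𝕜] [NormedSpace 𝕜 V]
    [SMulCommClass ℝ 𝕜 V] (a : 𝕜) :
    measureConvolution μ (a • f) = a • measureConvolution μ f := by
  ext x
  exact integral_smul a _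

theorem measureConvolution_eq_zero_of_le_norm {ρ r : ℝ} (hμ : ∀ᵐ y ∂μ, ‖y‖ ≤ ρ)
    (hf : ∀ x, r ≤ ‖x‖ → f x = 0) {x : E} (hx : r + ρ ≤ ‖x‖) : measureConvolution μ f x = 0 := by
  refine integral_eq_zero_of_ae ?_
  filter_upwards [hμ] with y hy
  refine hf _ ?_
  linarith [norm_sub_norm_le x y]

end Basic

variable [InnerProductSpace ℝ E] [FiniteDimensional ℝ E] [BorelSpace E] [MeasurableSpace β]

/-- Translation invariance of Lebesgue measure in product form. A general h covers both x - y and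
the translates x + R y of spherical means. -/
theorem measurePreserving_prod_sub (ν : Measure β) [SFinite ν] {h : β → E} (hh : Measurable h) :
    MeasurePreserving (fun p : E × β => (p.2, p.1 - h p.2)) (volume.prod ν) (ν.prod volume) := by
  have h1 : MeasurePreserving (fun p : β × E => (p.1, p.2 - h p.1)) (ν.prod volume)
      (ν.prod volume) :=
    (MeasurePreserving.id ν).skew_product (g := fun b x => x - h b) (by fun_prop)
      (Eventually.of_forall fun b => (measurePreserving_sub_right volume (h b)).map_eq)
  exact h1.comp Measure.measurePreserving_swap

theorem quasiMeasurePreserving_prod_sub (ν : Measure β) [SFinite ν] {h : β → E}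
    (hh : Measurable h) :
    Measure.QuasiMeasurePreserving (fun p : E × β => p.1 - h p.2) (volume.prod ν) volume :=
  Measure.quasiMeasurePreserving_snd.comp (measurePreserving_prod_sub ν hh).quasiMeasurePreserving

theorem integrable_prod_sub [NormedAddCommGroup V] (ν : Measure β) [IsFiniteMeasure ν] {h : β → E} (hh : Measurable h)
    {f : E → V} (hf : Integrable f) :
    Integrable (fun p : E × β => f (p.1 - h p.2)) (volume.prod ν) :=
  (measurePreserving_prod_sub ν hh).integrable_comp_of_integrable (hf.comp_snd ν)

theorem ae_ae_eq_comp_sub (ν : Measure β) [SFinite ν] {h : β → E} (hh : Measurable h)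
    {f g : E → V} (hfg : f =ᵐ[volume] g) :
    ∀ᵐ x ∂(volume : Measure E), ∀ᵐ y ∂ν, f (x - h y) = g (x - h y) :=
  Measure.ae_ae_of_ae_prod ((quasiMeasurePreserving_prod_sub ν hh).ae hfg)

variable [NormedAddCommGroup V] {μ : Measure E} {f g : E → V}

theorem ae_integrable_comp_sub [IsFiniteMeasure μ] (hf : Integrable f) :
    ∀ᵐ x ∂(volume : Measure E), Integrable (fun y => f (x - y)) μ :=
  (integrable_prod_sub μ measurable_id hf).prod_right_ae

variable [NormedSpace ℝ V]

theorem measureConvolution_congr_ae [SFinite μ] (hfg : f =ᵐ[volume] g) :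
    measureConvolution μ f =ᵐ[volume] measureConvolution μ g := by
  filter_upwards [ae_ae_eq_comp_sub μ measurable_id hfg] with x hx
  exact integral_congr_ae hx

theorem measureConvolution_add_ae [IsFiniteMeasure μ] (hf : Integrable f) (hg : Integrable g) :
    measureConvolution μ (f + g) =ᵐ[volume] measureConvolution μ f + measureConvolution μ g := by
  filter_upwards [ae_integrable_comp_sub (μ := μ) hf,
    ae_integrable_comp_sub (μ := μ) hg] with x hx hx'
  exact integral_add hx hx'

theorem aestronglyMeasurable_measureConvolution [SFinite μ]
    (hf : AEStronglyMeasurable f volume) :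
    AEStronglyMeasurable (measureConvolution μ f) volume :=
  (hf.comp_quasiMeasurePreserving
    (quasiMeasurePreserving_prod_sub μ measurable_id)).integral_prod_right'

theorem lintegral_lintegral_comp_sub [IsProbabilityMeasure μ] {φ : E → ENNReal}
    (hφ : AEMeasurable φ volume) : ∫⁻ x, ∫⁻ y, φ (x - y) ∂μ = ∫⁻ x, φ x := by
  have hq := quasiMeasurePreserving_prod_sub μ (h := id) measurable_id
  have hm : AEMeasurable (fun p : E × E => φ (p.1 - p.2)) (volume.prod μ) :=
    hφ.comp_quasiMeasurePreserving hq
  rw [← lintegral_prod _ hm]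
  have hmp := measurePreserving_prod_sub μ (h := id) measurable_id
  have hφ' : AEMeasurable (fun p : E × E => φ p.2) (μ.prod volume) :=
    hφ.comp_quasiMeasurePreserving Measure.quasiMeasurePreserving_snd
  have h1 : ∫⁻ p, φ p.2 ∂(μ.prod volume) = ∫⁻ p : E × E, φ (p.1 - p.2) ∂(volume.prod μ) := by
    rw [← hmp.map_eq] at hφ' ⊢
    exact lintegral_map' hφ' hmp.measurable.aemeasurable
  rw [← h1, lintegral_prod _ hφ']
  simp

/-- Convolution with a probability measure is a contraction of `L²`. -/
theorem eLpNorm_measureConvolution_le [IsProbabilityMeasure μ]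
    (hf : AEStronglyMeasurable f volume) :
    eLpNorm (measureConvolution μ f) 2 volume ≤ eLpNorm f 2 volume := by
  have hle : eLpNorm (measureConvolution μ f) 2 volume ^ 2 ≤ eLpNorm f 2 volume ^ 2 := by
    rw [eLpNorm_two_sq_eq_lintegral, eLpNorm_two_sq_eq_lintegral]
    have hae : AEMeasurable (fun x => ‖f x‖ₑ ^ 2) volume := hf.enorm.pow_const 2
    rw [← lintegral_lintegral_comp_sub (μ := μ) hae]
    have hmeas : ∀ᵐ x ∂(volume : Measure E), AEStronglyMeasurable (fun y => f (x - y)) μ :=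
      (hf.comp_quasiMeasurePreserving
        (quasiMeasurePreserving_prod_sub μ measurable_id)).prodMk_left
    refine lintegral_mono_ae ?_
    filter_upwards [hmeas] with x hx
    rw [← eLpNorm_two_sq_eq_lintegral μ fun y => f (x - y)]
    refine pow_le_pow_left' ?_ 2
    calc ‖measureConvolution μ f x‖ₑ ≤ ∫⁻ y, ‖f (x - y)‖ₑ ∂μ := enorm_integral_le_lintegral_enorm _
      _ = eLpNorm (fun y => f (x - y)) 1 μ := eLpNorm_one_eq_lintegral_enorm.symm
      _ ≤ eLpNorm (fun y => f (x - y)) 2 μ :=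
        eLpNorm_le_eLpNorm_of_exponent_le one_le_two hx
  exact (ENNReal.pow_le_pow_left_iff two_ne_zero).1 hle

theorem memLp_two_measureConvolution [IsProbabilityMeasure μ] (hf : MemLp f 2) :
    MemLp (measureConvolution μ f) 2 :=
  ⟨aestronglyMeasurable_measureConvolution hf.1, (eLpNorm_measureConvolution_le hf.1).trans_lt hf.2⟩

-- The factor -2π translates between the kernel exp(-2πi⟨x, ξ⟩) of `𝓕` and the kernel exp(i⟨x, k⟩)
-- of `charFun`.
open FourierTransform in
theorem fourier_measureConvolution [IsProbabilityMeasure μ] {f : E → ℂ} (hf : Integrable f)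
    (ξ : E) :
    𝓕 (measureConvolution μ f) ξ = charFun μ ((-(2 * Real.pi)) • ξ) * 𝓕 f ξ := by
  set e : E → ℂ := fun x => Complex.exp (↑(-2 * Real.pi * inner ℝ x ξ) * Complex.I)
  have he : ∀ x, ‖e x‖ = 1 := fun x => Complex.norm_exp_ofReal_mul_I _
  have hadd : ∀ x y, e (x + y) = e y * e x := by
    intro x y
    simp only [e]
    rw [← Complex.exp_add, inner_add_left]
    congr 1
    push_cast
    ring
  have hec : Continuous e := by fun_prop
  rw [Real.fourier_eq', Real.fourier_eq', charFun_apply]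
  have hint : Integrable (Function.uncurry fun x y => e x * f (x - y)) (volume.prod μ) := by
    refine (integrable_prod_sub μ measurable_id hf).bdd_mul (c := 1)
      (hec.comp continuous_fst).aestronglyMeasurable (Eventually.of_forall fun p => ?_)
    exact (he p.1).le
  calc ∫ x, e x • measureConvolution μ f x
      = ∫ x, ∫ y, e x * f (x - y) ∂μ := by
        congr 1
        ext x
        rw [measureConvolution, smul_eq_mul, integral_const_mul]
    _ = ∫ y, (∫ x, e x * f (x - y)) ∂μ := integral_integral_swap hint
    _ = ∫ y, e y * (∫ x, e x • f x) ∂μ := by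
        congr 1
        ext y
        rw [← integral_add_right_eq_self _ y, ← integral_const_mul]
        congr 1
        ext x
        rw [add_sub_cancel_right, hadd, mul_assoc, smul_eq_mul]
    _ = (∫ y, e y ∂μ) * ∫ x, e x • f x := integral_mul_const _ _
    _ = _ := by
        congr 2
        ext y
        simp only [e, inner_smul_right]
        congr 3
        ring

end MeasureConvolution

/-! ### Causal diffusion as convolution with the Green measure. -/

section Diffusion

variable {N : ℕ} [NeZero N] {𝕜 : Type*} [RCLike 𝕜]

/-- Spheres are null sets, so nothing follows for a single given centre; Fubini gives the equality
for almost every centre. -/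
theorem sphericalMean_congr_ae (R : ℝ) {f g : EuclideanSpace ℝ (Fin N) → 𝕜}
    (hfg : f =ᵐ[volume] g) : sphericalMean R f =ᵐ[volume] sphericalMean R g := by
  filter_upwards [ae_ae_eq_comp_sub (unitSphereMeasure N)
    (h := fun y => (-R) • y) (by fun_prop) hfg] with x hx
  rw [sphericalMean_eq_integral, sphericalMean_eq_integral]
  refine integral_congr_ae ?_
  filter_upwards [hx] with y hy
  simpa using hy

/-- The signs match because f(x - (z - R y)) = f((x + R y) - z). The function is measurable
everywhere because μ may be singular. -/
theorem sphericalMean_measureConvolution (R : ℝ) {μ : Measure (EuclideanSpace ℝ (Fin N))}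
    [IsProbabilityMeasure μ] {f : EuclideanSpace ℝ (Fin N) → 𝕜} (hf : StronglyMeasurable f)
    (hfi : Integrable f) :
    sphericalMean R (measureConvolution μ f) =ᵐ[volume]
      measureConvolution (sphericalMeanMeasure R μ) f := by
  have := isProbabilityMeasure_sphericalMeanMeasure R μ
  filter_upwards [ae_integrable_comp_sub (μ := sphericalMeanMeasure R μ) hfi] with x hx
  have hm : StronglyMeasurable fun y => f (x - y) :=
    hf.comp_measurable (measurable_const.sub measurable_id)
  have hφ : Measurable fun p : EuclideanSpace ℝ (Fin N) × EuclideanSpace ℝ (Fin N) =>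
    p.1 - R • p.2 := by fun_prop
  rw [sphericalMean_eq_integral, measureConvolution]
  rw [sphericalMeanMeasure_eq_map] at hx ⊢
  rw [integral_map hφ.aemeasurable hm.aestronglyMeasurable, integral_prod_symm]
  · congr 1
    ext y
    rw [measureConvolution]
    congr 1
    ext z
    congr 1
    abel
  · exact (integrable_map_measure hm.aestronglyMeasurable hφ.aemeasurable).1 hx

theorem diffusionState_ae_eq (c τ : ℝ) {u : EuclideanSpace ℝ (Fin N) → 𝕜}
    (hu : StronglyMeasurable u) (hui : Integrable u) (n : ℕ) :
    diffusionState c τ u n =ᵐ[volume] measureConvolution (greenState N c τ n) u := by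
  induction n with
  | zero =>
    refine Eventually.of_forall fun x => ?_
    simp [diffusionState, greenState, measureConvolution]
  | succ n ih =>
    exact (sphericalMean_congr_ae _ ih).trans (sphericalMean_measureConvolution _ hu hui)

/-- Causal diffusion is convolution with the Green function. -/
theorem causalDiffusion_ae_eq (c τ t : ℝ) {u : EuclideanSpace ℝ (Fin N) → 𝕜}
    (hu : StronglyMeasurable u) (hui : Integrable u) :
    causalDiffusion c τ u t =ᵐ[volume] measureConvolution (greenMeasure N c τ t) u := by
  unfold causalDiffusion greenMeasure
  split_ifs
  · refine Eventually.of_forall fun x => ?_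
    simp [measureConvolution]
  · exact (sphericalMean_congr_ae _ (diffusionState_ae_eq c τ hu hui _)).trans
      (sphericalMean_measureConvolution _ hu hui)

end Diffusion

/-! ### Real and complex scalars; functions extended by zero. -/

/-- The real-linear isometric embedding of an `RCLike` field into the complex numbers. -/
noncomputable def RCLike.toComplexLI (𝕜 : Type*) [RCLike 𝕜] : 𝕜 →ₗᵢ[ℝ] ℂ where
  toLinearMap := (RCLike.map 𝕜 ℂ).toLinearMap
  norm_map' z := by
    rw [← sq_eq_sq₀ (norm_nonneg _) (norm_nonneg _), RCLike.norm_sq_eq_def, RCLike.norm_sq_eq_def]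
    simp

section ExtensionByZero

variable {E 𝕜 : Type*} [RCLike 𝕜] [NormedAddCommGroup E] [InnerProductSpace ℝ E]
  [FiniteDimensional ℝ E] [MeasurableSpace E] [BorelSpace E] {Ω : Set E}

theorem stronglyMeasurable_indicator_Lp (hΩ : MeasurableSet Ω)
    (u : Lp 𝕜 2 (volume.restrict Ω)) : StronglyMeasurable (Ω.indicator u) :=
  (Lp.stronglyMeasurable u).indicator hΩ

theorem memLp_indicator_Lp (hΩ : MeasurableSet Ω) (u : Lp 𝕜 2 (volume.restrict Ω)) :
    MemLp (Ω.indicator u) 2 :=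
  (memLp_indicator_iff_restrict hΩ).2 (Lp.memLp u)

theorem integrable_indicator_Lp (hΩ : MeasurableSet Ω) (hfin : volume Ω ≠ ⊤)
    (u : Lp 𝕜 2 (volume.restrict Ω)) : Integrable (Ω.indicator u) := by
  have : IsFiniteMeasure (volume.restrict Ω) := isFiniteMeasure_restrict.2 hfin
  exact (integrable_indicator_iff hΩ).2 ((Lp.memLp u).integrable one_le_two)

theorem indicator_ae_eq_of_ae_eq_restrict (hΩ : MeasurableSet Ω) {f g : E → 𝕜}
    (h : f =ᵐ[volume.restrict Ω] g) : Ω.indicator f =ᵐ[volume] Ω.indicator g := by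
  filter_upwards [(ae_restrict_iff' hΩ).1 h] with x hx
  by_cases hxΩ : x ∈ Ω
  · simp [hxΩ, hx hxΩ]
  · simp [hxΩ]

theorem eLpNorm_indicator_Lp (hΩ : MeasurableSet Ω) (u : Lp 𝕜 2 (volume.restrict Ω)) :
    eLpNorm (Ω.indicator u) 2 volume = ‖u‖ₑ := by
  rw [eLpNorm_indicator_eq_eLpNorm_restrict hΩ, Lp.enorm_def]

/-- Convolution with a compactly supported probability measure, as an operator between `L²` spaces
of bounded domains. -/
theorem exists_convolution_operator {r ρ : ℝ} (hΩ : MeasurableSet Ω) (hsub : Ω ⊆ ball 0 r)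
    {μ : Measure E} [IsProbabilityMeasure μ] (hμ : ∀ᵐ y ∂μ, ‖y‖ ≤ ρ) :
    ∃ F : Lp 𝕜 2 (volume.restrict Ω) →L[𝕜] Lp 𝕜 2 (volume.restrict (ball (0 : E) (r + ρ))),
      ∀ u, (ball 0 (r + ρ)).indicator (F u) =ᵐ[volume] measureConvolution μ (Ω.indicator u) := by
  set D := ball (0 : E) (r + ρ)
  have hD : MeasurableSet D := measurableSet_ball
  have hfin : volume Ω ≠ ⊤ := (measure_mono hsub).trans_lt measure_ball_lt_top |>.ne
  have hmem : ∀ u : Lp 𝕜 2 (volume.restrict Ω),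
      MemLp (measureConvolution μ (Ω.indicator u)) 2 (volume.restrict D) := fun u =>
    (memLp_two_measureConvolution (memLp_indicator_Lp hΩ u)).restrict D
  let F₀ : Lp 𝕜 2 (volume.restrict Ω) →ₗ[𝕜] Lp 𝕜 2 (volume.restrict D) :=
    { toFun := fun u => (hmem u).toLp
      map_add' := fun u v => by
        rw [← MemLp.toLp_add, MemLp.toLp_eq_toLp_iff]
        refine ae_restrict_of_ae ((measureConvolution_congr_ae
          (indicator_ae_eq_of_ae_eq_restrict hΩ (Lp.coeFn_add u v))).trans ?_)
        rw [Set.indicator_add']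
        exact measureConvolution_add_ae (integrable_indicator_Lp hΩ hfin u)
          (integrable_indicator_Lp hΩ hfin v)
      map_smul' := fun a u => by
        rw [RingHom.id_apply, ← MemLp.toLp_const_smul, MemLp.toLp_eq_toLp_iff]
        refine ae_restrict_of_ae ((measureConvolution_congr_ae
          (indicator_ae_eq_of_ae_eq_restrict hΩ (Lp.coeFn_smul a u))).trans ?_)
        rw [← measureConvolution_const_smul]
        have : Ω.indicator (a • ⇑u) = a • Ω.indicator ⇑u := Set.indicator_const_smul Ω a u
        rw [this] }
  have hbound : ∀ u, ‖F₀ u‖ ≤ 1 * ‖u‖ := by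
    intro u
    rw [one_mul, ← enorm_le_iff_norm_le, ← eLpNorm_indicator_Lp hΩ u]
    change ‖(hmem u).toLp‖ₑ ≤ _
    rw [Lp.enorm_toLp]
    exact (eLpNorm_restrict_le _ _ _ _).trans
      (eLpNorm_measureConvolution_le (memLp_indicator_Lp hΩ u).1)
  refine ⟨F₀.mkContinuous 1 hbound, fun u => ?_⟩
  have h1 : D.indicator (F₀ u) =ᵐ[volume] D.indicator (measureConvolution μ (Ω.indicator u)) :=
    indicator_ae_eq_of_ae_eq_restrict hD (hmem u).coeFn_toLp
  refine h1.trans (Eventually.of_forall fun x => ?_)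
  by_cases hx : x ∈ D
  · simp [hx]
  · rw [Set.indicator_of_notMem hx]
    -- Outside the larger ball the convolution vanishes by the support condition, so restricting it
    -- to the ball loses nothing.
    refine (measureConvolution_eq_zero_of_le_norm hμ (r := r) (fun y hy => ?_) ?_).symm
    · exact Set.indicator_of_notMem (fun hyΩ => absurd (mem_ball_zero_iff.1 (hsub hyΩ))
        (not_lt.2 hy)) _
    · simpa [D] using hx

end ExtensionByZero

/-! ### Injectivity and compactness by Fourier transform. -/

section FourierSide

open FourierTransform

variable {E 𝕜 : Type*} [RCLike 𝕜] [NormedAddCommGroup E] [InnerProductSpace ℝ E]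
  [FiniteDimensional ℝ E] [MeasurableSpace E] [BorelSpace E] {Ω D : Set E}

/-- The Fourier transform of the extension by zero of an `L²` function on `Ω`. -/
noncomputable def fourierExtension (u : Lp 𝕜 2 (volume.restrict Ω)) : E → ℂ :=
  𝓕 fun x => RCLike.toComplexLI 𝕜 (Ω.indicator u x)

theorem memLp_toComplexLI_indicator (hΩ : MeasurableSet Ω) (u : Lp 𝕜 2 (volume.restrict Ω)) :
    MemLp (fun x => RCLike.toComplexLI 𝕜 (Ω.indicator u x)) 2 :=
  (RCLike.toComplexLI 𝕜).toContinuousLinearMap.comp_memLp' (memLp_indicator_Lp hΩ u)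

theorem integrable_toComplexLI_indicator (hΩ : MeasurableSet Ω) (hfin : volume Ω ≠ ⊤)
    (u : Lp 𝕜 2 (volume.restrict Ω)) :
    Integrable (fun x => RCLike.toComplexLI 𝕜 (Ω.indicator u x)) :=
  (RCLike.toComplexLI 𝕜).toContinuousLinearMap.integrable_comp (integrable_indicator_Lp hΩ hfin u)

theorem continuous_fourierExtension (hΩ : MeasurableSet Ω) (hfin : volume Ω ≠ ⊤)
    (u : Lp 𝕜 2 (volume.restrict Ω)) : Continuous (fourierExtension u) :=
  VectorFourier.fourierIntegral_continuous Real.continuous_fourierChar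
    (by exact continuous_inner) (integrable_toComplexLI_indicator hΩ hfin u)

theorem eLpNorm_fourierExtension (hΩ : MeasurableSet Ω) (hfin : volume Ω ≠ ⊤)
    (u : Lp 𝕜 2 (volume.restrict Ω)) : eLpNorm (fourierExtension u) 2 volume = ‖u‖ₑ := by
  rw [fourierExtension, eLpNorm_fourier_eq (integrable_toComplexLI_indicator hΩ hfin u)
    (memLp_toComplexLI_indicator hΩ u), ← eLpNorm_indicator_Lp hΩ u]
  exact eLpNorm_congr_norm_ae (Eventually.of_forall fun x => LinearIsometry.norm_map _ _)

variable {μ : Measure E} [IsProbabilityMeasure μ]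

/-- If `v` is the convolution of `u` with `μ`, the Fourier transform of `v` is that of `u`
multiplied with the characteristic function of `μ`. -/
theorem fourierExtension_eq_charFun_mul (hΩ : MeasurableSet Ω) (hΩfin : volume Ω ≠ ⊤)
    {u : Lp 𝕜 2 (volume.restrict Ω)} {v : Lp 𝕜 2 (volume.restrict D)}
    (huv : D.indicator v =ᵐ[volume] measureConvolution μ (Ω.indicator u)) (ξ : E) :
    fourierExtension v ξ = charFun μ ((-(2 * Real.pi)) • ξ) * fourierExtension u ξ := by
  rw [fourierExtension, fourierExtension,
    ← fourier_measureConvolution (integrable_toComplexLI_indicator hΩ hΩfin u)]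
  refine Real.fourier_congr_ae ?_ ξ
  filter_upwards [huv] with x hx
  rw [hx]
  exact (LinearIsometry.integral_comp_comm _ _).symm

/-- Along each ray the Fourier transform of u vanishes at nearby points, hence by continuity at
every ξ ≠ 0, even where the symbol is zero. Plancherel concludes. -/
theorem eq_zero_of_convolution_eq_zero (hΩ : MeasurableSet Ω) (hΩfin : volume Ω ≠ ⊤)
    [Nontrivial E] (hne : ∀ k : E, k ≠ 0 → ∀ᶠ t : ℝ in nhdsWithin 1 {1}ᶜ, charFun μ (t • k) ≠ 0)
    {u : Lp 𝕜 2 (volume.restrict Ω)}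
    (hu : D.indicator (0 : Lp 𝕜 2 (volume.restrict D)) =ᵐ[volume]
      measureConvolution μ (Ω.indicator u)) (hD : MeasurableSet D) : u = 0 := by
  have hcont := continuous_fourierExtension hΩ hΩfin u
  have hv : fourierExtension (0 : Lp 𝕜 2 (volume.restrict D)) = 0 := by
    ext ξ
    have h0 : D.indicator (0 : Lp 𝕜 2 (volume.restrict D)) =ᵐ[volume] D.indicator (0 : E → 𝕜) :=
      indicator_ae_eq_of_ae_eq_restrict hD (Lp.coeFn_zero _ _ _)
    have h1 : (fun x => RCLike.toComplexLI 𝕜 (D.indicator (0 : Lp 𝕜 2 (volume.restrict D)) x))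
        =ᵐ[volume] fun _ => 0 := by
      filter_upwards [h0] with x hx
      rw [hx]
      simp
    rw [fourierExtension, Real.fourier_congr_ae h1, Real.fourier_eq']
    simp
  have hzero : ∀ ξ : E, ξ ≠ 0 → fourierExtension u ξ = 0 := by
    intro ξ hξ
    have hk : (-(2 * Real.pi)) • ξ ≠ 0 :=
      smul_ne_zero (neg_ne_zero.2 (by positivity)) hξ
    have hev : ∀ᶠ t : ℝ in nhdsWithin 1 {1}ᶜ, fourierExtension u (t • ξ) = 0 := by
      filter_upwards [hne _ hk] with t ht
      have := fourierExtension_eq_charFun_mul hΩ hΩfin hu (t • ξ)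
      rw [hv, smul_comm] at this
      exact (mul_eq_zero.1 this.symm).resolve_left ht
    have hlim : Tendsto (fun t : ℝ => fourierExtension u (t • ξ)) (nhdsWithin 1 {1}ᶜ)
        (nhds (fourierExtension u ((1 : ℝ) • ξ))) :=
      ((hcont.comp (continuous_id.smul continuous_const)).tendsto 1).mono_left nhdsWithin_le_nhds
    rw [one_smul] at hlim
    exact tendsto_nhds_unique (hlim.congr' hev) tendsto_const_nhds
  have hae : fourierExtension u =ᵐ[volume] 0 := by
    have : ∀ᵐ ξ ∂(volume : Measure E), ξ ≠ 0 := by simp [ae_iff]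
    filter_upwards [this] with ξ hξ
    exact hzero ξ hξ
  have hnorm := eLpNorm_fourierExtension hΩ hΩfin u
  rw [eLpNorm_congr_ae hae, eLpNorm_zero] at hnorm
  exact enorm_eq_zero.1 hnorm.symm

/-- Bessel's inequality for h on Ω. A real h belongs to the space for either scalar field, which is
why the Fourier kernel is later split into cosine and sine. -/
theorem sum_sq_norm_integral_smul_indicator_le (hΩ : MeasurableSet Ω) (hΩfin : volume Ω ≠ ⊤)
    {ι : Type*} {e : ι → Lp 𝕜 2 (volume.restrict Ω)} (he : Orthonormal 𝕜 e) {h : E → ℝ}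
    (hc : Continuous h) (hh : ∀ x, |h x| ≤ 1) (s : Finset ι) :
    ∑ i ∈ s, ‖∫ x, h x • Ω.indicator (e i) x‖ ^ 2 ≤
      ((measureUnivNNReal (volume.restrict Ω) : ℝ) ^ (2 : ENNReal).toReal⁻¹) ^ 2 := by
  have : IsFiniteMeasure (volume.restrict Ω) := isFiniteMeasure_restrict.2 hΩfin
  have hb : ∀ x, ‖(h x : 𝕜)‖ ≤ 1 := fun x => by simpa using hh x
  have hmem : MemLp (fun x => (h x : 𝕜)) 2 (volume.restrict Ω) :=
    MemLp.of_bound (by fun_prop) 1 (Eventually.of_forall hb)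
  set v := hmem.toLp
  have hv : ‖v‖ ≤ (measureUnivNNReal (volume.restrict Ω) : ℝ) ^ (2 : ENNReal).toReal⁻¹ := by
    have := Lp.norm_le_of_ae_bound (f := v) (C := 1) zero_le_one (by
      filter_upwards [hmem.coeFn_toLp] with x hx
      rw [hx]
      exact hb x)
    simpa using this
  have hinner : ∀ i, ‖∫ x, h x • Ω.indicator (e i) x‖ = ‖inner 𝕜 (e i) v‖ := by
    intro i
    rw [norm_inner_symm, L2.inner_def]
    congr 1
    have h1 : ∀ x, h x • Ω.indicator (e i) x = Ω.indicator (fun x => h x • e i x) x := by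
      intro x
      by_cases hx : x ∈ Ω <;> simp [hx]
    simp_rw [h1]
    rw [integral_indicator hΩ]
    refine integral_congr_ae ?_
    filter_upwards [hmem.coeFn_toLp] with x hx
    rw [hx, RCLike.inner_apply, RCLike.conj_ofReal, RCLike.real_smul_eq_coe_mul, mul_comm]
  simp_rw [hinner]
  exact (he.sum_inner_products_le v).trans (pow_le_pow_left₀ (norm_nonneg _) hv 2)

theorem norm_fourierExtension_le (hΩ : MeasurableSet Ω) (hΩfin : volume Ω ≠ ⊤)
    (u : Lp 𝕜 2 (volume.restrict Ω)) (ξ : E) :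
    ‖fourierExtension u ξ‖ ≤
      ‖∫ x, Real.cos (-2 * Real.pi * inner ℝ x ξ) • Ω.indicator u x‖ +
        ‖∫ x, Real.sin (-2 * Real.pi * inner ℝ x ξ) • Ω.indicator u x‖ := by
  have hint := integrable_indicator_Lp hΩ hΩfin u
  have hI : ∀ h : E → ℝ, Continuous h → (∀ x, |h x| ≤ 1) →
      Integrable fun x => RCLike.toComplexLI 𝕜 (h x • Ω.indicator u x) := fun h hc hh =>
    (RCLike.toComplexLI 𝕜).toContinuousLinearMap.integrable_comp
      (hint.bdd_smul 1 hc.aestronglyMeasurable (Eventually.of_forall hh))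
  have hcos := hI (fun x => Real.cos (-2 * Real.pi * inner ℝ x ξ)) (by fun_prop)
    fun x => Real.abs_cos_le_one _
  have hsin := hI (fun x => Real.sin (-2 * Real.pi * inner ℝ x ξ)) (by fun_prop)
    fun x => Real.abs_sin_le_one _
  have key : fourierExtension u ξ =
      RCLike.toComplexLI 𝕜 (∫ x, Real.cos (-2 * Real.pi * inner ℝ x ξ) • Ω.indicator u x) +
      Complex.I * RCLike.toComplexLI 𝕜
        (∫ x, Real.sin (-2 * Real.pi * inner ℝ x ξ) • Ω.indicator u x) := by
    rw [fourierExtension, Real.fourier_eq', ← LinearIsometry.integral_comp_comm,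
      ← LinearIsometry.integral_comp_comm, ← integral_const_mul,
      ← integral_add hcos (hsin.const_mul _)]
    congr 1
    ext x
    rw [map_smul, map_smul, Complex.exp_mul_I, ← Complex.ofReal_cos, ← Complex.ofReal_sin,
      Complex.real_smul, Complex.real_smul, smul_eq_mul]
    ring
  rw [key]
  refine (norm_add_le _ _).trans (le_of_eq ?_)
  rw [norm_mul, Complex.norm_I, one_mul, LinearIsometry.norm_map, LinearIsometry.norm_map]

/-- Bessel's inequality for the Fourier transforms of an orthonormal family on a bounded domain. -/
theorem exists_sum_sq_norm_fourierExtension_le (hΩ : MeasurableSet Ω) (hΩfin : volume Ω ≠ ⊤)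
    {ι : Type*} {e : ι → Lp 𝕜 2 (volume.restrict Ω)} (he : Orthonormal 𝕜 e) :
    ∃ C : ℝ, ∀ ξ (s : Finset ι), ∑ i ∈ s, ‖fourierExtension (e i) ξ‖ ^ 2 ≤ C := by
  set B := ((measureUnivNNReal (volume.restrict Ω) : ℝ) ^ (2 : ENNReal).toReal⁻¹) ^ 2
  refine ⟨2 * (B + B), fun ξ s => ?_⟩
  have h1 := sum_sq_norm_integral_smul_indicator_le hΩ hΩfin he
    (h := fun x => Real.cos (-2 * Real.pi * inner ℝ x ξ)) (by fun_prop)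
    (fun x => Real.abs_cos_le_one _) s
  have h2 := sum_sq_norm_integral_smul_indicator_le hΩ hΩfin he
    (h := fun x => Real.sin (-2 * Real.pi * inner ℝ x ξ)) (by fun_prop)
    (fun x => Real.abs_sin_le_one _) s
  refine le_trans ?_ (mul_le_mul_of_nonneg_left (add_le_add h1 h2) zero_le_two)
  rw [← Finset.sum_add_distrib, Finset.mul_sum]
  refine Finset.sum_le_sum fun i _ => ?_
  exact (pow_le_pow_left₀ (norm_nonneg _) (norm_fourierExtension_le hΩ hΩfin (e i) ξ) 2).trans
    add_sq_le

/-- Convolution with a probability measure whose characteristic function is square integrable is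
a Hilbert–Schmidt operator between bounded domains, and hence compact. -/
theorem isCompactOperator_of_convolution (hΩ : MeasurableSet Ω) (hΩfin : volume Ω ≠ ⊤)
    (hD : MeasurableSet D) (hDfin : volume D ≠ ⊤)
    (hμ : ∫⁻ ξ, ‖charFun μ ((-(2 * Real.pi)) • ξ)‖ₑ ^ 2 ≠ ⊤)
    (F : Lp 𝕜 2 (volume.restrict Ω) →L[𝕜] Lp 𝕜 2 (volume.restrict D))
    (hF : ∀ u, D.indicator (F u) =ᵐ[volume] measureConvolution μ (Ω.indicator u)) :
    IsCompactOperator F := by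
  obtain ⟨w, b, -⟩ := exists_hilbertBasis 𝕜 (Lp 𝕜 2 (volume.restrict Ω))
  obtain ⟨C, hC⟩ := exists_sum_sq_norm_fourierExtension_le hΩ hΩfin b.orthonormal
  set I := ∫⁻ ξ, ‖charFun μ ((-(2 * Real.pi)) • ξ)‖ₑ ^ 2
  refine b.isCompactOperator_of_sum_sq_le F (C := (I * ENNReal.ofReal C).toReal) fun s => ?_
  have hnorm : ∀ u, ‖F u‖ₑ ^ 2 =
      ∫⁻ ξ, ‖charFun μ ((-(2 * Real.pi)) • ξ)‖ₑ ^ 2 * ‖fourierExtension u ξ‖ₑ ^ 2 := by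
    intro u
    rw [← eLpNorm_fourierExtension hD hDfin, eLpNorm_two_sq_eq_lintegral]
    congr 1
    ext ξ
    rw [fourierExtension_eq_charFun_mul hΩ hΩfin (hF u), enorm_mul, mul_pow]
  have hmeas : Measurable fun ξ : E => ‖charFun μ ((-(2 * Real.pi)) • ξ)‖ₑ ^ 2 := by
    have := measurable_charFun (μ := μ)
    fun_prop
  -- By Plancherel the sum is ∫ |μ̂|² ∑ |û_i|², and the inner sum is at most C at every frequency.
  have hle : ∑ i ∈ s, ‖F (b i)‖ₑ ^ 2 ≤ I * ENNReal.ofReal C := by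
    have hm : ∀ i ∈ s, Measurable fun ξ => ‖charFun μ ((-(2 * Real.pi)) • ξ)‖ₑ ^ 2 *
        ‖fourierExtension (b i) ξ‖ₑ ^ 2 := fun i _ =>
      hmeas.mul ((continuous_fourierExtension hΩ hΩfin (b i)).measurable.enorm.pow_const 2)
    simp_rw [hnorm]
    rw [← lintegral_finsetSum _ hm, ← lintegral_mul_const _ hmeas]
    refine lintegral_mono fun ξ => ?_
    rw [← Finset.mul_sum]
    gcongr
    calc ∑ i ∈ s, ‖fourierExtension (b i) ξ‖ₑ ^ 2
        = ENNReal.ofReal (∑ i ∈ s, ‖fourierExtension (b i) ξ‖ ^ 2) := by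
          rw [ENNReal.ofReal_sum_of_nonneg fun i _ => sq_nonneg _]
          simp_rw [ENNReal.ofReal_pow (norm_nonneg _), ofReal_norm]
      _ ≤ ENNReal.ofReal C := ENNReal.ofReal_le_ofReal (hC ξ s)
  rw [← ENNReal.ofReal_le_iff_le_toReal (ENNReal.mul_ne_top hμ ENNReal.ofReal_ne_top),
    ENNReal.ofReal_sum_of_nonneg fun i _ => sq_nonneg _]
  simpa only [ENNReal.ofReal_pow (norm_nonneg _), ofReal_norm] using hle

end FourierSide

/-! ### Two-sided bounds for the symbol. -/

section GreenFunction

variable {N : ℕ} {c τ T : ℝ}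

theorem norm_greenFourier (k : EuclideanSpace ℝ (Fin N)) :
    ‖greenFourier N c τ T k‖ =
      (2 * Real.pi) ^ (-(N : ℝ) / 2) * ‖charFun (greenMeasure N c τ T) k‖ := by
  rw [greenFourier, norm_mul, Complex.norm_real, Real.norm_of_nonneg (by positivity)]

theorem stepCount_add_one (hτ : 0 < τ) (hT : 0 < T) : stepCount τ T + 1 = ⌈T / τ⌉₊ := by
  have : 0 < ⌈T / τ⌉₊ := Nat.ceil_pos.2 (div_pos hT hτ)
  unfold stepCount
  omega

/-- Positivity, due to the half-open time intervals, makes the last factor decay like the others. -/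
theorem last_radius_pos_le (hc : 0 < c) (hτ : 0 < τ) (hT : 0 < T) :
    0 < c * (T - stepCount τ T * τ) ∧ c * (T - stepCount τ T * τ) ≤ c * τ := by
  have hs := (stepCount_spec hτ hT _).1 rfl
  exact ⟨mul_pos hc (by linarith [hs.1]), mul_le_mul_of_nonneg_left (by linarith [hs.2]) hc.le⟩

variable [NeZero N]

theorem charFun_greenMeasure_eq_sphereProfile (hc : 0 < c) (hτ : 0 < τ) (hT : 0 < T)
    (k : EuclideanSpace ℝ (Fin N)) :
    charFun (greenMeasure N c τ T) k =
      ((sphereProfile N (c * τ * ‖k‖) ^ stepCount τ T *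
        sphereProfile N (c * (T - stepCount τ T * τ) * ‖k‖) : ℝ) : ℂ) := by
  have hR := (last_radius_pos_le hc hτ hT).1
  rw [charFun_greenMeasure hT, charFun_unitSphereMeasure, charFun_unitSphereMeasure, norm_smul,
    norm_smul, norm_neg, norm_neg, Real.norm_of_nonneg (mul_pos hc hτ).le,
    Real.norm_of_nonneg hR.le]
  push_cast
  rfl

theorem norm_charFun_greenMeasure (hc : 0 < c) (hτ : 0 < τ) (hT : 0 < T)
    (k : EuclideanSpace ℝ (Fin N)) :
    ‖charFun (greenMeasure N c τ T) k‖ =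
      |sphereProfile N (c * τ * ‖k‖)| ^ stepCount τ T *
        |sphereProfile N (c * (T - stepCount τ T * τ) * ‖k‖)| := by
  rw [charFun_greenMeasure_eq_sphereProfile hc hτ hT, Complex.norm_real, Real.norm_eq_abs, abs_mul,
    abs_pow]

theorem exists_norm_charFun_greenMeasure_le (hc : 0 < c) (hτ : 0 < τ) (hT : 0 < T) :
    ∃ K, 0 < K ∧ ∀ k : EuclideanSpace ℝ (Fin N), ‖charFun (greenMeasure N c τ T) k‖ ≤
      K * (1 + ‖k‖) ^ (-((⌈T / τ⌉₊ : ℝ) * ((N : ℝ) - 1) / 2)) := by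
  obtain ⟨hb, hba⟩ := last_radius_pos_le hc hτ hT
  set a := c * τ with ha
  set b := c * (T - stepCount τ T * τ)
  obtain ⟨C, hC, hCle⟩ := exists_abs_sphereProfile_le N
  have hα : 0 ≤ ((N : ℝ) - 1) / 2 := by
    have : (1 : ℝ) ≤ N := by exact_mod_cast NeZero.one_le
    linarith
  set α := ((N : ℝ) - 1) / 2 with hαdef
  -- With this choice d(1 + |k|) ≤ 1 + R|k| for all R ≥ b, which treats both radii at once.
  set d := min 1 b
  have hd : 0 < d := lt_min one_pos hb
  have hφ : ∀ k : EuclideanSpace ℝ (Fin N), ∀ R, b ≤ R →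
      |sphereProfile N (R * ‖k‖)| ≤ C * d ^ (-α) * (1 + ‖k‖) ^ (-α) := by
    intro k R hR
    refine (hCle _ (mul_nonneg (hb.le.trans hR) (norm_nonneg k))).trans ?_
    rw [mul_assoc, ← Real.mul_rpow hd.le (by positivity)]
    refine mul_le_mul_of_nonneg_left (Real.rpow_le_rpow_of_nonpos (by positivity) ?_
      (by linarith)) hC.le
    have h1 : d ≤ 1 := min_le_left _ _
    have h2 : d * ‖k‖ ≤ R * ‖k‖ :=
      mul_le_mul_of_nonneg_right ((min_le_right _ _).trans hR) (norm_nonneg k)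
    linarith
  refine ⟨(C * d ^ (-α)) ^ (stepCount τ T + 1), by positivity, fun k => ?_⟩
  rw [norm_charFun_greenMeasure hc hτ hT, ← stepCount_add_one hτ hT]
  calc |sphereProfile N (a * ‖k‖)| ^ stepCount τ T * |sphereProfile N (b * ‖k‖)|
      ≤ (C * d ^ (-α) * (1 + ‖k‖) ^ (-α)) ^ stepCount τ T *
          (C * d ^ (-α) * (1 + ‖k‖) ^ (-α)) := by
        gcongr
        exacts [hφ k a hba, hφ k b le_rfl]
    _ = (C * d ^ (-α)) ^ (stepCount τ T + 1) * ((1 + ‖k‖) ^ (-α)) ^ (stepCount τ T + 1) := by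
        rw [← pow_succ, mul_pow]
    _ = _ := by
        rw [← Real.rpow_mul_natCast (by positivity)]
        congr 2
        rw [hαdef]
        ring

/-- The squared symbol decays with exponent ⌈T/τ⌉(N-1), which must exceed the dimension N. -/
theorem lintegral_charFun_greenMeasure_sq_ne_top (hc : 0 < c) (hτ : 0 < τ) (hT : 0 < T)
    (hN : (N : ℝ) < ⌈T / τ⌉₊ * ((N : ℝ) - 1)) :
    ∫⁻ ξ : EuclideanSpace ℝ (Fin N),
      ‖charFun (greenMeasure N c τ T) ((-(2 * Real.pi)) • ξ)‖ₑ ^ 2 ≠ ⊤ := by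
  obtain ⟨K, hK, hle⟩ := exists_norm_charFun_greenMeasure_le (N := N) hc hτ hT
  set p := (⌈T / τ⌉₊ : ℝ) * ((N : ℝ) - 1) with hp
  have hp0 : 0 ≤ p := (Nat.cast_nonneg N).trans hN.le
  have hint : Integrable (fun ξ : EuclideanSpace ℝ (Fin N) => K ^ 2 * (1 + ‖ξ‖) ^ (-p)) :=
    (integrable_one_add_norm (by simpa using hN)).const_mul _
  refine ne_top_of_le_ne_top hint.lintegral_lt_top.ne (lintegral_mono fun ξ => ?_)
  rw [← ofReal_norm, ← ENNReal.ofReal_pow (norm_nonneg _)]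
  refine ENNReal.ofReal_le_ofReal ?_
  have h1 : (1 : ℝ) + ‖ξ‖ ≤ 1 + ‖(-(2 * Real.pi)) • ξ‖ := by
    rw [norm_smul, norm_neg, Real.norm_of_nonneg (by positivity)]
    nlinarith [norm_nonneg ξ, Real.two_le_pi]
  calc ‖charFun (greenMeasure N c τ T) ((-(2 * Real.pi)) • ξ)‖ ^ 2
      ≤ (K * (1 + ‖ξ‖) ^ (-(p / 2))) ^ 2 := by
        refine pow_le_pow_left₀ (norm_nonneg _) ((hle _).trans ?_) 2
        exact mul_le_mul_of_nonneg_left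
          (Real.rpow_le_rpow_of_nonpos (by positivity) h1 (by linarith)) hK.le
    _ = K ^ 2 * (1 + ‖ξ‖) ^ (-p) := by
        rw [mul_pow, ← Real.rpow_mul_natCast (by positivity)]
        congr 2
        push_cast
        ring

theorem eventually_charFun_greenMeasure_ne_zero (hc : 0 < c) (hτ : 0 < τ) (hT : 0 < T)
    {k : EuclideanSpace ℝ (Fin N)} (hk : k ≠ 0) :
    ∀ᶠ t : ℝ in nhdsWithin 1 {1}ᶜ, charFun (greenMeasure N c τ T) (t • k) ≠ 0 := by
  have hk' : 0 < ‖k‖ := norm_pos_iff.2 hk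
  have key : ∀ R : ℝ, 0 < R →
      ∀ᶠ t : ℝ in nhdsWithin 1 {1}ᶜ, sphereProfile N (R * (t * ‖k‖)) ≠ 0 := by
    intro R hR
    have htend : Tendsto (fun t : ℝ => R * (t * ‖k‖)) (nhdsWithin 1 {1}ᶜ)
        (nhdsWithin (R * ‖k‖) {R * ‖k‖}ᶜ) := by
      refine tendsto_nhdsWithin_iff.2 ⟨?_, ?_⟩
      · have : Continuous fun t : ℝ => R * (t * ‖k‖) := by fun_prop
        have h := (this.tendsto 1).mono_left (nhdsWithin_le_nhds (s := {1}ᶜ))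
        rwa [one_mul] at h
      · filter_upwards [self_mem_nhdsWithin] with t ht h
        refine ht ?_
        have h' : R * (t * ‖k‖) = R * ‖k‖ := h
        have h2 := mul_left_cancel₀ hR.ne' h'
        exact mul_right_cancel₀ hk'.ne' (h2.trans (one_mul _).symm)
    exact htend.eventually (eventually_sphereProfile_ne_zero N (mul_pos hR hk'))
  have hpos : ∀ᶠ t : ℝ in nhdsWithin 1 {1}ᶜ, 0 < t :=
    (eventually_gt_nhds one_pos).filter_mono nhdsWithin_le_nhds
  filter_upwards [key _ (mul_pos hc hτ), key _ (last_radius_pos_le hc hτ hT).1, hpos]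
    with t h1 h2 h3
  rw [charFun_greenMeasure_eq_sphereProfile hc hτ hT, norm_smul, Real.norm_of_nonneg h3.le]
  exact Complex.ofReal_ne_zero.2 (mul_ne_zero (pow_ne_zero _ h1) h2)

/-- The envelope of the symbol of causal diffusion decreases exactly at a polynomial rate. -/
theorem envelope_greenFourier_isTheta (hc : 0 < c) (hτ : 0 < τ) (hT : 0 < T) :
    envelope (greenFourier N c τ T) =Θ[atTop]
      fun k : ℝ => k ^ (-((⌈T / τ⌉₊ : ℝ) * ((N : ℝ) - 1) / 2)) := by
  obtain ⟨hb, hba⟩ := last_radius_pos_le hc hτ hT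
  have hN1 : (1 : ℝ) ≤ N := by exact_mod_cast NeZero.one_le
  have hp0 : 0 ≤ (⌈T / τ⌉₊ : ℝ) * ((N : ℝ) - 1) / 2 := by
    have : 0 ≤ (N : ℝ) - 1 := by linarith
    positivity
  set M : ℝ := (2 * Real.pi) ^ (-(N : ℝ) / 2)
  have hM : 0 < M := by positivity
  have hnn : ∀ ρ, 0 ≤ envelope (greenFourier N c τ T) ρ := fun ρ =>
    Real.iSup_nonneg fun _ => norm_nonneg _
  constructor
  · obtain ⟨K, hK, hle⟩ := exists_norm_charFun_greenMeasure_le (N := N) hc hτ hT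
    refine IsBigO.of_bound (M * K) ?_
    filter_upwards [eventually_gt_atTop 0] with ρ hρ
    rw [Real.norm_of_nonneg (hnn ρ),
      Real.norm_of_nonneg (by positivity)]
    refine Real.iSup_le (fun k => ?_) (by positivity)
    rw [norm_greenFourier, mul_assoc]
    refine mul_le_mul_of_nonneg_left ((hle k).trans ?_) hM.le
    refine mul_le_mul_of_nonneg_left (Real.rpow_le_rpow_of_nonpos hρ ?_ (by linarith)) hK.le
    linarith [k.2]
  · obtain ⟨A, hA, hev⟩ := exists_le_abs_sphereProfile_mul N hb hba (stepCount τ T)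
    refine IsBigO.of_bound (M * A)⁻¹ ?_
    filter_upwards [hev, eventually_gt_atTop 0] with ρ ⟨s, hs, hle⟩ hρ
    rw [Real.norm_of_nonneg (hnn ρ),
      Real.norm_of_nonneg (by positivity), le_inv_mul_iff₀ (by positivity), mul_assoc]
    have hs0 : 0 ≤ s := hρ.le.trans hs
    have hnorm : ‖EuclideanSpace.single (0 : Fin N) s‖ = s := by
      rw [PiLp.norm_single, Real.norm_of_nonneg hs0]
    have hbdd : BddAbove (Set.range fun k : {k : EuclideanSpace ℝ (Fin N) // ρ ≤ ‖k‖} =>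
        ‖greenFourier N c τ T k‖) := by
      refine ⟨M * 1, ?_⟩
      rintro _ ⟨k, rfl⟩
      change ‖greenFourier N c τ T k‖ ≤ _
      rw [norm_greenFourier]
      exact mul_le_mul_of_nonneg_left (norm_charFun_le_one _) hM.le
    refine le_ciSup_of_le hbdd ⟨EuclideanSpace.single (0 : Fin N) s, by rwa [hnorm]⟩ ?_
    rw [norm_greenFourier, norm_charFun_greenMeasure hc hτ hT, hnorm]
    refine mul_le_mul_of_nonneg_left (le_trans (le_of_eq ?_) hle) hM.le
    rw [← stepCount_add_one hτ hT]
    congr 2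
    push_cast
    ring

end GreenFunction

/-! ### Assembly. -/

theorem mainTheorem1 {𝕜 : Type*} [RCLike 𝕜] (N : ℕ) (c τ T r : ℝ) (hc : 0 < c) (hτ : 0 < τ)
    (hT : (N = 2 ∧ 2 * τ < T) ∨ (3 ≤ N ∧ τ < T))
    (Ω₀ : Set (EuclideanSpace ℝ (Fin N))) (hopen : IsOpen Ω₀) (hne : Ω₀.Nonempty)
    (hsub : Ω₀ ⊆ ball 0 r) :
    ∃ F : Lp 𝕜 2 ((volume : Measure (EuclideanSpace ℝ (Fin N))).restrict Ω₀) →L[𝕜]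
        Lp 𝕜 2 ((volume : Measure (EuclideanSpace ℝ (Fin N))).restrict (ball 0 (r + c * T))),
      -- `F` is the forward operator `u ↦ v(·, T)`; functions on a subset are extended by zero
      (∀ u, (ball 0 (r + c * T)).indicator (F u) =ᵐ[volume]
        causalDiffusion c τ (Ω₀.indicator u) T) ∧
      -- `F` is convolution with the Green function
      (∀ u, (ball 0 (r + c * T)).indicator (F u) =ᵐ[volume]
        fun x => ∫ y, Ω₀.indicator u (x - y) ∂(greenMeasure N c τ T)) ∧
      ¬ FiniteDimensional 𝕜 (Lp 𝕜 2 ((volume : Measure (EuclideanSpace ℝ (Fin N))).restrict Ω₀)) ∧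
      IsCompactOperator F ∧
      Function.Injective F ∧
      IllPosed F ∧
      -- the envelope of the symbol decreases exactly at a polynomial rate
      envelope (greenFourier N c τ T) =Θ[atTop]
        (fun k : ℝ => k ^ (-((⌈T / τ⌉₊ : ℝ) * ((N : ℝ) - 1) / 2))) ∧
      ¬ ExponentiallyIllPosed F (greenFourier N c τ T) := by
  have hN2 : 2 ≤ N := by omega
  have : NeZero N := ⟨by omega⟩
  have : Nontrivial (EuclideanSpace ℝ (Fin N)) :=
    ⟨⟨0, EuclideanSpace.single 0 1, fun h => by simpa using congrArg (fun v => v 0) h⟩⟩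
  have hT0 : 0 < T := by rcases hT with ⟨-, h⟩ | ⟨-, h⟩ <;> linarith
  -- Here the two cases enter: for N = 2 there are at least 3 factors and 3 · 1 > 2; for N ≥ 3 there
  -- are at least 2, and 2(N-1) > N.
  have hdecay : (N : ℝ) < ⌈T / τ⌉₊ * ((N : ℝ) - 1) := by
    rcases hT with ⟨hN, h⟩ | ⟨hN, h⟩
    · have hm : 2 < ⌈T / τ⌉₊ := Nat.lt_ceil.2 ((lt_div_iff₀ hτ).2 (by exact_mod_cast h))
      have hm' : (3 : ℝ) ≤ ⌈T / τ⌉₊ := by exact_mod_cast hm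
      rw [hN]
      norm_num
      linarith
    · have hm : 1 < ⌈T / τ⌉₊ := Nat.lt_ceil.2 ((lt_div_iff₀ hτ).2 (by simpa using h))
      have hm' : (2 : ℝ) ≤ ⌈T / τ⌉₊ := by exact_mod_cast hm
      have hN' : (3 : ℝ) ≤ N := by exact_mod_cast hN
      nlinarith
  have hΩ := hopen.measurableSet
  have hΩfin : volume Ω₀ ≠ ⊤ := ((measure_mono hsub).trans_lt measure_ball_lt_top).ne
  have hDfin : volume (ball (0 : EuclideanSpace ℝ (Fin N)) (r + c * T)) ≠ ⊤ :=
    measure_ball_lt_top.ne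
  obtain ⟨F, hF⟩ := exists_convolution_operator (𝕜 := 𝕜) hΩ hsub
    (ae_norm_le_greenMeasure (N := N) hc hτ hT0)
  have hcompact : IsCompactOperator F :=
    isCompactOperator_of_convolution hΩ hΩfin measurableSet_ball hDfin
      (lintegral_charFun_greenMeasure_sq_ne_top hc hτ hT0 hdecay) F hF
  have hinj : Function.Injective F := by
    refine (injective_iff_map_eq_zero F).2 fun u hu => ?_
    have h := hF u
    rw [hu] at h
    exact eq_zero_of_convolution_eq_zero hΩ hΩfin
      (fun k hk => eventually_charFun_greenMeasure_ne_zero hc hτ hT0 hk) h measurableSet_ball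
  have hinf := not_finiteDimensional_Lp_two_restrict (𝕜 := 𝕜) hopen hne
  have hill : IllPosed F := fun he =>
    hinf (finiteDimensional_of_isCompactOperator_of_isEmbedding hcompact he)
  have htheta := envelope_greenFourier_isTheta (N := N) hc hτ hT0
  refine ⟨F, fun u => (hF u).trans ?_, hF, hinf, hcompact, hinj, hill, htheta, ?_⟩
  · exact (causalDiffusion_ae_eq c τ T (stronglyMeasurable_indicator_Lp hΩ u)
      (integrable_indicator_Lp hΩ hΩfin u)).symm
  · rintro ⟨-, a, b, ha, hb, hO⟩
    exact not_isBigO_rpow_exp_neg_mul_rpow _ ha hb (htheta.2.trans hO)
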